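/- **Notation.** For $\alpha,\beta>0$ let $\Delta_{\alpha,\beta}=\{z=x+iy\in\mathbb C:\ |x|<-\alpha y,\ |z|<\beta\}$. Let $\mathcal H$ be the set of functions $f$ that are analytic on a connected open set which, for every $\alpha>0$, contains $\Delta_{\alpha,\beta}$ for some $\beta>0$. For $f\in\mathcal H$, $\lim_{z\to0}f(z)=l$ means that for every $\alpha>0$ there is $\beta>0$ such that $f(z)\to l$ as $z\to 0$ within $\Delta_{\alpha,\beta}$ (non-tangential limit). We say that $f\in\mathcal H$ admits the Taylor expansion $f(z)=\sum_{i=0}^n a_iz^i+o(z^n)$ of order $n$, with $a_0,\dots,a_n\in\mathbb C$, if $f(z)=\sum_{i=0}^n a_iz^i+z^nv(z)$ for some $v\in\mathcal H$ with $\lim_{z\to0}v(z)=0$ (the identity being required on some $\Delta_{\alpha,\beta}$ for every $\alpha>0$). For a probability measure $\mu$ on $\mathbb R$, let $G_\mu(z)=\int_{\mathbb R}\frac{d\mu(t)}{z-t}$ for $\operatorname{Im}z>0$. For every $\alpha>0$, every $\varepsilon\in(0,\min\{\alpha,1\})$ and all sufficiently small $\beta>0$, the map $z\mapsto G_\mu(1/z)$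 is a conformal bijection of $\Delta_{\alpha,\beta}$ onto an open set $\mathcal D_{\alpha,\beta}$ with $\Delta_{\alpha-\varepsilon,(1-\varepsilon)\beta}\subset\mathcal D_{\alpha,\beta}\subset\Delta_{\alpha+\varepsilon,(1+\varepsilon)\beta}$. The inverses of these bijections define together, on the truncated cones $\Delta_{\alpha-\varepsilon,(1-\varepsilon)\beta}$ (with $\varepsilon=\frac12\min\{\alpha,1\}$, say), a function $L_\mu\in\mathcal H$. The $R$-transform of $\mu$ is $R_\mu(z)=\frac1{L_\mu(z)}-\frac1z$. If $\mu$ has a $p$-th moment, that is $\int_{\mathbb R}|t|^p\,d\mu(t)<\infty$, let $m_i(\mu)=\int_{\mathbb R} t^i\,d\mu(t)$ for $1\le i\le p$. The free cumulants $k_1(\mu),\dots,k_p(\mu)$ are the real numbers determined recursively by $$m_i(\mu)=\sum_{\pi\in \mathrm{NC}(i)}\ \prod_{V\text{ block of }\pi}k_{|V|}(\mu),\qquad 1\le i\le p,$$ where $\mathrm{NC}(i)$ is the set of non-crossing partitions of $\{1,\dots,i\}$, i.e. those for which there are no $j_1<j_2<j_3<j_4$ with $j_1,j_3$ in one block and $j_2,j_4$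 in a different block. **Theorem 1.3.** Let $p$ be a positive integer and $\mu$ a probability measure on $\mathbb R$. (a) If $\mu$ has a $p$-th moment, then $R_\mu$ admits the Taylor expansion $$R_\mu(z)=\sum_{i=0}^{p-1}k_{i+1}(\mu)\,z^i+o(z^{p-1}).$$ (b) Conversely, suppose that $p$ is even, or that the support of $\mu$ is bounded below, or that it is bounded above. If $R_\mu$ admits a Taylor expansion of order $p-1$ with real coefficients, then $\mu$ has a $p$-th moment. -/

import Mathlib

open MeasureTheory Filter Topology

namespace FreeProb

noncomputable section

/-! ### Truncated cones, functions of the class `ℋ`, non-tangential Taylor expansions -/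

/-- The truncated cone `Δ_{α,β} = {z = x + iy : |x| < -α y, |z| < β}` in the lower half-plane. -/
def truncCone (α β : ℝ) : Set ℂ := {z : ℂ | |z.re| < -(α * z.im) ∧ ‖z‖ < β}

/-- The space `ℋ`: `f` is analytic on a domain (a connected open set) which, for every `α > 0`,
contains `Δ_{α,β}` for some `β > 0`. The values of `f` off that domain are irrelevant. -/
def IsNTAnalytic (f : ℂ → ℂ) : Prop :=
  ∃ D : Set ℂ, IsOpen D ∧ IsConnected D ∧ AnalyticOnNhd ℂ f D ∧
    ∀ α : ℝ, 0 < α → ∃ β : ℝ, 0 < β ∧ truncCone α β ⊆ D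

/-- `f` has the non-tangential limit `l` at `0`. -/
def HasNTLimit (f : ℂ → ℂ) (l : ℂ) : Prop :=
  ∀ α : ℝ, 0 < α → ∃ β : ℝ, 0 < β ∧ Tendsto f (𝓝[truncCone α β] 0) (𝓝 l)

/-- `f ∈ ℋ` has the (non-tangential) Taylor expansion `f(z) = ∑_{i=0}^n a_i z^i + o(z^n)` at `0`:
there is `v ∈ ℋ` with non-tangential limit `0` such that `f(z) = ∑_{i=0}^n a_i z^i + z^n v(z)`
(on some `Δ_{α,β}` for each `α > 0`). -/
def HasNTTaylor (f : ℂ → ℂ) (n : ℕ) (a : ℕ → ℂ) : Prop :=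
  IsNTAnalytic f ∧ ∃ v : ℂ → ℂ, IsNTAnalytic v ∧ HasNTLimit v 0 ∧
    ∀ α : ℝ, 0 < α → ∃ β : ℝ, 0 < β ∧ ∀ z ∈ truncCone α β,
      f z = ∑ i ∈ Finset.range (n + 1), a i * z ^ i + z ^ n * v z

/-! ### The R-transform -/

/-- The Cauchy transform `G_μ(z) = ∫ dμ(t) / (z - t)` (used on the upper half-plane only). -/
def cauchyTransform (μ : Measure ℝ) (z : ℂ) : ℂ := ∫ t : ℝ, 1 / (z - (t : ℂ)) ∂μ

/-- The function `z ↦ G_μ(1/z)`, used on the lower half-plane only. -/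
def cauchyInv (μ : Measure ℝ) (z : ℂ) : ℂ := cauchyTransform μ (1 / z)

/-- The margin `ε` attached to the aperture `α`, a number in `(0, min {α, 1})`. -/
def margin (α : ℝ) : ℝ := min α 1 / 2

/-- `β` is small enough for the aperture `α`: with `ε = margin α`, for every positive `β' ≤ β` the
(analytic) map `z ↦ G_μ(1/z)` is injective on `Δ_{α,β'}`, and its image `𝒟_{α,β'}` satisfies
`Δ_{α-ε,(1-ε)β'} ⊆ 𝒟_{α,β'} ⊆ Δ_{α+ε,(1+ε)β'}`. -/
def IsGood (μ : Measure ℝ) (α β : ℝ) : Prop :=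
  0 < α ∧ 0 < β ∧ ∀ β' : ℝ, 0 < β' → β' ≤ β →
    Set.InjOn (cauchyInv μ) (truncCone α β') ∧
    truncCone (α - margin α) ((1 - margin α) * β') ⊆ cauchyInv μ '' truncCone α β' ∧
    cauchyInv μ '' truncCone α β' ⊆ truncCone (α + margin α) ((1 + margin α) * β')

/-- `z` is the value at `w` of the inverse of a bijection `G_μ(1/·) : Δ_{α,β} → 𝒟_{α,β}` with `β`
small enough, where `w` lies in the truncated cone `Δ_{α-ε,(1-ε)β} ⊆ 𝒟_{α,β}`. -/
def IsInverseValue (μ : Measure ℝ) (w z : ℂ) : Prop :=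
  ∃ α β : ℝ, IsGood μ α β ∧ w ∈ truncCone (α - margin α) ((1 - margin α) * β) ∧
    z ∈ truncCone α β ∧ cauchyInv μ z = w

/-- The inverses on the various truncated cones agree, so `L_μ` below is well defined. -/
theorem IsInverseValue.unique {μ : Measure ℝ} {w z₁ z₂ : ℂ}
    (h₁ : IsInverseValue μ w z₁) (h₂ : IsInverseValue μ w z₂) : z₁ = z₂ := by
  have key : ∀ {α₁ β₁ α₂ β₂ : ℝ} {x₁ x₂ : ℂ}, IsGood μ α₁ β₁ → IsGood μ α₂ β₂ →
      w ∈ truncCone (α₁ - margin α₁) ((1 - margin α₁) * β₁) →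
      w ∈ truncCone (α₂ - margin α₂) ((1 - margin α₂) * β₂) →
      x₁ ∈ truncCone α₁ β₁ → x₂ ∈ truncCone α₂ β₂ → cauchyInv μ x₁ = w → cauchyInv μ x₂ = w →
      α₁ ≤ α₂ → x₁ = x₂ := by
    intro α₁ β₁ α₂ β₂ x₁ x₂ g₁ g₂ w₁ w₂ hx₁ hx₂ e₁ e₂ hα
    obtain ⟨a₁, b₁, g₁⟩ := g₁
    obtain ⟨a₂, b₂, g₂⟩ := g₂
    have m₁ : margin α₁ < 1 := by
      unfold margin; have := min_le_right α₁ 1; linarith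
    have m₂ : margin α₂ < 1 := by
      unfold margin; have := min_le_right α₂ 1; linarith
    have m₁₂ : margin α₁ ≤ margin α₂ := by
      unfold margin; have := min_le_min_right 1 hα; linarith
    have hz : (1 - margin α₁) * ‖x₁‖ ≤ ‖w‖ := by
      by_contra! hlt
      have hpos : 0 < ‖x₁‖ := by
        by_contra! h0
        have := norm_nonneg w
        nlinarith
      obtain ⟨y, hy, hyw⟩ := (g₁ ‖x₁‖ hpos hx₁.2.le).2.1 ⟨w₁.1, hlt⟩
      have : y = x₁ := (g₁ β₁ b₁ le_rfl).1 ⟨hy.1, hy.2.trans hx₁.2⟩ hx₁ (hyw.trans e₁.symm)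
      exact lt_irrefl _ (this ▸ hy.2)
    have him : x₁.im < 0 := by
      have := hx₁.1; have := abs_nonneg x₁.re; by_contra! h0; nlinarith
    refine (g₂ β₂ b₂ le_rfl).1 ⟨?_, ?_⟩ hx₂ (e₁.trans e₂.symm)
    · have := hx₁.1; nlinarith
    · have := w₂.2
      have h3 : (1 - margin α₂) * ‖x₁‖ < (1 - margin α₂) * β₂ := by
        have := norm_nonneg x₁; nlinarith
      exact lt_of_mul_lt_mul_left h3 (by linarith)
  obtain ⟨α₁, β₁, g₁, w₁, hx₁, e₁⟩ := h₁
  obtain ⟨α₂, β₂, g₂, w₂, hx₂, e₂⟩ := h₂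
  rcases le_total α₁ α₂ with h | h
  · exact key g₁ g₂ w₁ w₂ hx₁ hx₂ e₁ e₂ h
  · exact (key g₂ g₁ w₂ w₁ hx₂ hx₁ e₂ e₁ h).symm

open Classical in
/-- `L_μ`, the inverse of `z ↦ G_μ(1/z)` defined by the inverses on the truncated cones together
(and `0` where none of them is defined). -/
def inverseL (μ : Measure ℝ) (w : ℂ) : ℂ :=
  if h : ∃ z, IsInverseValue μ w z then h.choose else 0

theorem inverseL_eq {μ : Measure ℝ} {w z : ℂ} (h : IsInverseValue μ w z) : inverseL μ w = z := by
  have h' : ∃ z, IsInverseValue μ w z := ⟨z, h⟩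
  rw [inverseL, dif_pos h']
  exact h'.choose_spec.unique h

/-- The R-transform `R_μ(z) = K_μ(z) - 1/z`, where `K_μ = 1/L_μ`. -/
def rTransform (μ : Measure ℝ) (z : ℂ) : ℂ := 1 / inverseL μ z - 1 / z

/-! ### Free cumulants -/

/-- A partition of `{0, …, n-1}` is non-crossing if there are no `j₁ < j₂ < j₃ < j₄` with `j₁, j₃`
in one block and `j₂, j₄` in another one. -/
def IsNonCrossing {n : ℕ} (π : Finpartition (Finset.univ : Finset (Fin n))) : Prop :=
  ∀ V ∈ π.parts, ∀ W ∈ π.parts, V ≠ W →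
    ¬ ∃ j₁ j₂ j₃ j₄ : Fin n, j₁ < j₂ ∧ j₂ < j₃ ∧ j₃ < j₄ ∧ j₁ ∈ V ∧ j₃ ∈ V ∧ j₂ ∈ W ∧ j₄ ∈ W

open Classical in
/-- The set `NC(n)` of non-crossing partitions of an `n`-element chain. -/
def NC (n : ℕ) : Finset (Finpartition (Finset.univ : Finset (Fin n))) :=
  Finset.univ.filter IsNonCrossing

open Classical in
/-- The free cumulants of a sequence of moments `m`, obtained by solving recursively
`m_n = ∑_{π ∈ NC(n)} ∏_{V ∈ π} k_{|V|}` for the term `k_n` of the one-block partition. The other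
partitions are those all of whose blocks have fewer than `n` elements. -/
def cumulantOfMoments (m : ℕ → ℝ) (n : ℕ) : ℝ :=
  m n - ∑ π ∈ ((NC n).filter fun π => ∀ V ∈ π.parts, V.card < n).attach,
    ∏ V ∈ π.1.parts.attach, cumulantOfMoments m V.1.card
termination_by n
decreasing_by exact (Finset.mem_filter.mp π.2).2 V.1 V.2

/-- The moment-cumulant formula, which characterizes the free cumulants. -/
theorem moment_eq_sum_cumulant (m : ℕ → ℝ) {n : ℕ} (hn : 1 ≤ n) :
    m n = ∑ π ∈ NC n, ∏ V ∈ π.parts, cumulantOfMoments m V.card := by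
  classical
  have hne : (Finset.univ : Finset (Fin n)) ≠ ⊥ := by
    have : Nonempty (Fin n) := ⟨⟨0, hn⟩⟩
    exact Finset.univ_nonempty.ne_empty
  have hsub : (NC n).filter (fun π => ¬ ∀ V ∈ π.parts, V.card < n) =
      {Finpartition.indiscrete hne} := by
    ext π
    simp only [NC, Finset.mem_filter, Finset.mem_univ, true_and, Finset.mem_singleton, not_forall,
      not_lt]
    constructor
    · rintro ⟨-, V, hV, hc⟩
      have hVu : V = Finset.univ := by
        apply Finset.eq_univ_of_card
        simpa using le_antisymm (by simpa using V.card_le_univ) hc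
      ext W
      simp only [Finpartition.indiscrete_parts, Finset.mem_singleton]
      constructor
      · intro hW
        by_contra hWne
        have hd := π.disjoint hW hV (fun h => hWne (h.trans hVu))
        simp only [Function.onFun, id, hVu] at hd
        exact π.ne_bot hW (disjoint_top.mp (by simpa only [Finset.top_eq_univ] using hd))
      · rintro rfl
        exact hVu ▸ hV
    · rintro rfl
      refine ⟨?_, Finset.univ, by simp, by simp⟩
      intro V hV W hW hVW
      simp only [Finpartition.indiscrete_parts, Finset.mem_singleton] at hV hW
      exact absurd (hV.trans hW.symm) hVW
  rw [← Finset.sum_filter_add_sum_filter_not (NC n) (fun π => ∀ V ∈ π.parts, V.card < n), hsub,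
    Finset.sum_singleton, Finpartition.indiscrete_parts, Finset.prod_singleton, Finset.card_univ,
    Fintype.card_fin]
  conv_rhs => rw [cumulantOfMoments]
  rw [Finset.sum_attach ((NC n).filter fun π => ∀ V ∈ π.parts, V.card < n)
    (fun π => ∏ V ∈ π.parts.attach, cumulantOfMoments m V.1.card)]
  have : ∀ π : Finpartition (Finset.univ : Finset (Fin n)),
      ∏ V ∈ π.parts.attach, cumulantOfMoments m V.1.card =
        ∏ V ∈ π.parts, cumulantOfMoments m V.card := fun π =>
    Finset.prod_attach π.parts (fun V => cumulantOfMoments m V.card)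
  simp only [this]
  ring

/-- The `i`-th free cumulant `k_i(μ)`, meaningful when `μ` has an `i`-th moment. -/
def freeCumulant (μ : Measure ℝ) (i : ℕ) : ℝ := cumulantOfMoments (fun j => ∫ t : ℝ, t ^ j ∂μ) i

end

end FreeProb

namespace FreeProb
/-- `P` is the set of blocks of a non-crossing partition of the finite set `s`. -/
structure IsNCPartition (s : Finset ℕ) (P : Finset (Finset ℕ)) : Prop where
  nonempty : ∀ V ∈ P, V.Nonempty
  subset : ∀ V ∈ P, V ⊆ s
  cover : ∀ x ∈ s, ∃ V ∈ P, x ∈ V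
  eq_of_mem : ∀ V ∈ P, ∀ W ∈ P, ∀ x, x ∈ V → x ∈ W → V = W
  noncrossing : ∀ V ∈ P, ∀ W ∈ P, ∀ a b c d, a < b → b < c → c < d →
    a ∈ V → c ∈ V → b ∈ W → d ∈ W → V = W

open Classical in
/-- The non-crossing partitions of a finite set of natural numbers, as sets of blocks. -/
noncomputable def ncPartitions (s : Finset ℕ) : Finset (Finset (Finset ℕ)) :=
  s.powerset.powerset.filter (IsNCPartition s)

theorem mem_ncPartitions {s : Finset ℕ} {P : Finset (Finset ℕ)} :
    P ∈ ncPartitions s ↔ IsNCPartition s P := by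
  simp only [ncPartitions, Finset.mem_filter, Finset.mem_powerset, and_iff_right_iff_imp]
  intro h V hV
  exact Finset.mem_powerset.2 (h.subset V hV)

/-- The weight of a partition, where the block of `a` is counted with `j` additional elements. -/
def ncWeight (k : ℕ → ℝ) (j a : ℕ) (P : Finset (Finset ℕ)) : ℝ :=
  ∏ V ∈ P, k (V.card + if a ∈ V then j else 0)

theorem ncWeight_zero (k : ℕ → ℝ) (a : ℕ) (P : Finset (Finset ℕ)) :
    ncWeight k 0 a P = ∏ V ∈ P, k V.card := by
  simp [ncWeight]

/-- The sum of the weights of the non-crossing partitions of `{a, …, b-1}`. -/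
noncomputable def ncSum (k : ℕ → ℝ) (j a b : ℕ) : ℝ :=
  ∑ P ∈ ncPartitions (Finset.Ico a b), ncWeight k j a P

/-- Enlarge the block of `i` by the element `a`. -/
def enlarge (a i : ℕ) (V : Finset ℕ) : Finset ℕ := if i ∈ V then insert a V else V

/-- Join partitions of `{a+1, …, i-1}` and `{i, …, b-1}`, adding `a` to the block of `i`. -/
def glue (a i : ℕ) (x : Finset (Finset ℕ) × Finset (Finset ℕ)) : Finset (Finset ℕ) :=
  x.1 ∪ x.2.image (enlarge a i)

theorem ncPartitions_empty : ncPartitions ∅ = {∅} := by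
  ext P
  rw [mem_ncPartitions, Finset.mem_singleton]
  constructor
  · intro h
    refine Finset.eq_empty_of_forall_notMem fun V hV => ?_
    obtain ⟨x, hx⟩ := h.nonempty V hV
    exact absurd (h.subset V hV hx) (Finset.notMem_empty x)
  · rintro rfl
    constructor <;> simp

theorem ncSum_self (k : ℕ → ℝ) (j a : ℕ) : ncSum k j a a = 1 := by
  simp [ncSum, ncPartitions_empty, ncWeight]

theorem isNCPartition_insert_singleton {a b : ℕ} (hab : a < b) {P : Finset (Finset ℕ)}
    (h : IsNCPartition (Finset.Ico (a + 1) b) P) :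
    IsNCPartition (Finset.Ico a b) (insert {a} P) := by
  have hlt : ∀ V ∈ P, ∀ x ∈ V, a < x ∧ x < b := fun V hV x hx => by
    have := h.subset V hV hx; simp at this; omega
  constructor
  · intro V hV
    rcases Finset.mem_insert.1 hV with rfl | hV
    · simp
    · exact h.nonempty V hV
  · intro V hV x hx
    rcases Finset.mem_insert.1 hV with rfl | hV
    · simp at hx; simp; omega
    · have := hlt V hV x hx; simp; omega
  · intro x hx
    simp only [Finset.mem_Ico] at hx
    by_cases hxa : x = a
    · exact ⟨{a}, by simp, by simp [hxa]⟩
    · obtain ⟨V, hV, hxV⟩ := h.cover x (by simp; omega)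
      exact ⟨V, Finset.mem_insert_of_mem hV, hxV⟩
  · intro V hV W hW x hxV hxW
    rcases Finset.mem_insert.1 hV with rfl | hV <;> rcases Finset.mem_insert.1 hW with rfl | hW
    · rfl
    · have := hlt W hW x hxW; simp at hxV; omega
    · have := hlt V hV x hxV; simp at hxW; omega
    · exact h.eq_of_mem V hV W hW x hxV hxW
  · intro V hV W hW p q r s hpq hqr hrs hp hr hq hs
    rcases Finset.mem_insert.1 hV with rfl | hV <;> rcases Finset.mem_insert.1 hW with rfl | hW
    · rfl
    · simp at hp hr; omega
    · simp at hq hs; omega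
    · exact h.noncrossing V hV W hW p q r s hpq hqr hrs hp hr hq hs

theorem isNCPartition_erase_singleton {a b : ℕ} {P : Finset (Finset ℕ)}
    (h : IsNCPartition (Finset.Ico a b) P) (ha : {a} ∈ P) :
    IsNCPartition (Finset.Ico (a + 1) b) (P.erase {a}) := by
  constructor
  · intro V hV
    exact h.nonempty V (Finset.mem_of_mem_erase hV)
  · intro V hV x hx
    have h1 := h.subset V (Finset.mem_of_mem_erase hV) hx
    have h2 : x ≠ a := by
      rintro rfl
      exact Finset.ne_of_mem_erase hV
        (h.eq_of_mem V (Finset.mem_of_mem_erase hV) _ ha x hx (by simp))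
    simp at h1 ⊢; omega
  · intro x hx
    simp only [Finset.mem_Ico] at hx
    obtain ⟨V, hV, hxV⟩ := h.cover x (by simp; omega)
    refine ⟨V, Finset.mem_erase.2 ⟨?_, hV⟩, hxV⟩
    rintro rfl
    simp at hxV; omega
  · intro V hV W hW
    exact h.eq_of_mem V (Finset.mem_of_mem_erase hV) W (Finset.mem_of_mem_erase hW)
  · intro V hV W hW
    exact h.noncrossing V (Finset.mem_of_mem_erase hV) W (Finset.mem_of_mem_erase hW)

theorem sum_ncWeight_singleton (k : ℕ → ℝ) (j : ℕ) {a b : ℕ} (hab : a < b) :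
    ∑ P ∈ ncPartitions (Finset.Ico a b) with {a} ∈ P, ncWeight k j a P =
      k (1 + j) * ncSum k 0 (a + 1) b := by
  rw [ncSum, Finset.mul_sum]
  have hnot : ∀ P ∈ ncPartitions (Finset.Ico (a + 1) b), ∀ V ∈ P, a ∉ V := fun P hP V hV hx => by
    have := (mem_ncPartitions.1 hP).subset V hV hx; simp at this
  refine Finset.sum_nbij' (fun P => P.erase {a}) (fun P => insert {a} P) ?_ ?_ ?_ ?_ ?_
  · intro P hP
    simp only [Finset.mem_filter, mem_ncPartitions] at hP ⊢
    exact isNCPartition_erase_singleton hP.1 hP.2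
  · intro P hP
    simp only [Finset.mem_filter, mem_ncPartitions] at hP ⊢
    exact ⟨isNCPartition_insert_singleton hab hP, by simp⟩
  · intro P hP
    exact Finset.insert_erase (Finset.mem_filter.1 hP).2
  · intro P hP
    exact Finset.erase_insert fun h => hnot P hP _ h (by simp)
  · intro P hP
    simp only [Finset.mem_filter, mem_ncPartitions] at hP
    rw [ncWeight_zero, ncWeight, ← Finset.mul_prod_erase P _ hP.2]
    simp only [Finset.card_singleton, Finset.mem_singleton, if_true]
    congr 1
    refine Finset.prod_congr rfl fun V hV => ?_
    rw [if_neg, add_zero]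
    exact hnot _ (mem_ncPartitions.2 (isNCPartition_erase_singleton hP.1 hP.2)) V hV

/-- `i` is the element following `a` in the block of `a`. -/
def IsSecond (a i : ℕ) (P : Finset (Finset ℕ)) : Prop :=
  ∃ V ∈ P, a ∈ V ∧ i ∈ V ∧ ∀ x ∈ V, x = a ∨ i ≤ x

theorem enlarge_erase {a i : ℕ} {V : Finset ℕ} (ha : a ∉ V) :
    (enlarge a i V).erase a = V := by
  unfold enlarge
  split_ifs
  · exact Finset.erase_insert ha
  · exact Finset.erase_eq_of_notMem ha

theorem mem_enlarge {a i x : ℕ} {V : Finset ℕ} :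
    x ∈ enlarge a i V ↔ x ∈ V ∨ (x = a ∧ i ∈ V) := by
  unfold enlarge
  split_ifs with h <;> simp [h, or_comm]

theorem isNCPartition_glue {a i b : ℕ} (hai : a < i) (hib : i < b) {Q S : Finset (Finset ℕ)}
    (hQ : IsNCPartition (Finset.Ico (a + 1) i) Q) (hS : IsNCPartition (Finset.Ico i b) S) :
    IsNCPartition (Finset.Ico a b) (glue a i (Q, S)) := by
  have hQlt : ∀ V ∈ Q, ∀ x ∈ V, a < x ∧ x < i := fun V hV x hx => by
    have := hQ.subset V hV hx; simp at this; omega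
  have hSlt : ∀ V ∈ S, ∀ x ∈ V, i ≤ x ∧ x < b := fun V hV x hx => by
    have := hS.subset V hV hx; simp at this; omega
  have hmem : ∀ V, V ∈ glue a i (Q, S) ↔ V ∈ Q ∨ ∃ U ∈ S, enlarge a i U = V := by
    intro V; simp [glue]
  have hSlt' : ∀ V ∈ S, ∀ x ∈ enlarge a i V, x = a ∨ (i ≤ x ∧ x < b) := fun V hV x hx => by
    rcases mem_enlarge.1 hx with h | h
    · exact Or.inr (hSlt V hV x h)
    · exact Or.inl h.1
  constructor
  · intro V hV
    rcases (hmem V).1 hV with hV | ⟨U, hU, rfl⟩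
    · exact hQ.nonempty V hV
    · obtain ⟨x, hx⟩ := hS.nonempty U hU
      exact ⟨x, mem_enlarge.2 (Or.inl hx)⟩
  · intro V hV x hx
    rcases (hmem V).1 hV with hV | ⟨U, hU, rfl⟩
    · have := hQlt V hV x hx; simp; omega
    · have := hSlt' U hU x hx; simp; omega
  · intro x hx
    simp only [Finset.mem_Ico] at hx
    rcases lt_or_ge x i with hxi | hxi
    · by_cases hxa : x = a
      · obtain ⟨U, hU, hiU⟩ := hS.cover i (by simp; omega)
        exact ⟨_, (hmem _).2 (Or.inr ⟨U, hU, rfl⟩), mem_enlarge.2 (Or.inr ⟨hxa, hiU⟩)⟩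
      · obtain ⟨U, hU, hiU⟩ := hQ.cover x (by simp; omega)
        exact ⟨U, (hmem _).2 (Or.inl hU), hiU⟩
    · obtain ⟨U, hU, hiU⟩ := hS.cover x (by simp; omega)
      exact ⟨_, (hmem _).2 (Or.inr ⟨U, hU, rfl⟩), mem_enlarge.2 (Or.inl hiU)⟩
  · intro V hV W hW x hxV hxW
    rcases (hmem V).1 hV with hV | ⟨U, hU, rfl⟩ <;>
      rcases (hmem W).1 hW with hW | ⟨U', hU', rfl⟩
    · exact hQ.eq_of_mem V hV W hW x hxV hxW
    · have := hQlt V hV x hxV; have := hSlt' U' hU' x hxW; omega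
    · have := hQlt W hW x hxW; have := hSlt' U hU x hxV; omega
    · congr 1
      rcases mem_enlarge.1 hxV with h1 | h1 <;> rcases mem_enlarge.1 hxW with h2 | h2
      · exact hS.eq_of_mem U hU U' hU' x h1 h2
      · have := hSlt U hU x h1; omega
      · have := hSlt U' hU' x h2; omega
      · exact hS.eq_of_mem U hU U' hU' i h1.2 h2.2
  · intro V hV W hW p q r s hpq hqr hrs hp hr hq hs
    rcases (hmem V).1 hV with hV | ⟨U, hU, rfl⟩ <;>
      rcases (hmem W).1 hW with hW | ⟨U', hU', rfl⟩
    · exact hQ.noncrossing V hV W hW p q r s hpq hqr hrs hp hr hq hs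
    · have := hQlt V hV p hp; have := hQlt V hV r hr
      have := hSlt' U' hU' q hq; omega
    · have := hQlt W hW q hq; have := hQlt W hW s hs
      have := hSlt' U hU r hr; omega
    · congr 1
      have h2 : q ∈ U' := by
        rcases mem_enlarge.1 hq with h | h
        · exact h
        · have := hSlt' U hU p hp; omega
      have h3 : r ∈ U := by
        rcases mem_enlarge.1 hr with h | h
        · exact h
        · have := hSlt' U hU p hp; omega
      have h4 : s ∈ U' := by
        rcases mem_enlarge.1 hs with h | h
        · exact h
        · have := hSlt' U hU p hp; omega
      rcases mem_enlarge.1 hp with h1 | h1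
      · exact hS.noncrossing U hU U' hU' p q r s hpq hqr hrs h1 h3 h2 h4
      · rcases eq_or_lt_of_le (hSlt U' hU' q h2).1 with h | h
        · exact hS.eq_of_mem U hU U' hU' i h1.2 (h ▸ h2)
        · exact hS.noncrossing U hU U' hU' i q r s h hqr hrs h1.2 h3 h2 h4

theorem isSecond_glue {a i b : ℕ} (hib : i < b) {Q S : Finset (Finset ℕ)}
    (hS : IsNCPartition (Finset.Ico i b) S) : IsSecond a i (glue a i (Q, S)) := by
  obtain ⟨U, hU, hiU⟩ := hS.cover i (by simp; omega)
  refine ⟨enlarge a i U, Finset.mem_union_right _ (Finset.mem_image_of_mem _ hU), mem_enlarge.2 (Or.inr ⟨rfl, hiU⟩), mem_enlarge.2 (Or.inl hiU), ?_⟩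
  intro x hx
  rcases mem_enlarge.1 hx with h | h
  · have := hS.subset U hU h; simp at this; omega
  · exact Or.inl h.1

theorem block_of_isSecond {a i b : ℕ} {P : Finset (Finset ℕ)}
    (hP : IsNCPartition (Finset.Ico a b) P) (hi : IsSecond a i P) (hai : a < i)
    {W : Finset ℕ} (hW : W ∈ P) (hn : ¬ W ⊆ Finset.Ico (a + 1) i) :
    (a ∈ W ∧ i ∈ W ∧ ∀ x ∈ W, x = a ∨ i ≤ x) ∨ (a ∉ W ∧ i ∉ W ∧ ∀ x ∈ W, i ≤ x) := by
  obtain ⟨V, hV, haV, hiV, hxV⟩ := hi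
  by_cases hWV : W = V
  · subst hWV; exact Or.inl ⟨haV, hiV, hxV⟩
  · have haW : a ∉ W := fun h => hWV (hP.eq_of_mem W hW V hV a h haV)
    have hiW : i ∉ W := fun h => hWV (hP.eq_of_mem W hW V hV i h hiV)
    refine Or.inr ⟨haW, hiW, ?_⟩
    intro x hx
    by_contra! hlt
    obtain ⟨y, hy, hyn⟩ := Finset.not_subset.1 hn
    have hxa : x ≠ a := fun h => haW (h ▸ hx)
    have hya : y ≠ a := fun h => haW (h ▸ hy)
    have hyi : y ≠ i := fun h => hiW (h ▸ hy)
    have h1 := hP.subset W hW hx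
    have h2 := hP.subset W hW hy
    simp only [Finset.mem_Ico] at h1 h2 hyn
    exact hWV (hP.noncrossing V hV W hW a x i y (by omega) hlt (by omega) haV hiV hx hy).symm

/-- The partition of `{a+1, …, i-1}` induced by a partition. -/
def innerPart (a i : ℕ) (P : Finset (Finset ℕ)) : Finset (Finset ℕ) :=
  P.filter (· ⊆ Finset.Ico (a + 1) i)

/-- The partition of `{i, …, b-1}` induced by a partition. -/
def outerPart (a i : ℕ) (P : Finset (Finset ℕ)) : Finset (Finset ℕ) :=
  (P.filter (¬ · ⊆ Finset.Ico (a + 1) i)).image (·.erase a)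

theorem isNCPartition_innerPart {a i b : ℕ} (hai : a < i) (hib : i < b) {P : Finset (Finset ℕ)}
    (hP : IsNCPartition (Finset.Ico a b) P) (hi : IsSecond a i P) :
    IsNCPartition (Finset.Ico (a + 1) i) (innerPart a i P) := by
  have hsub : ∀ V ∈ innerPart a i P, V ∈ P := fun V hV => (Finset.mem_filter.1 hV).1
  constructor
  · exact fun V hV => hP.nonempty V (hsub V hV)
  · exact fun V hV => (Finset.mem_filter.1 hV).2
  · intro x hx
    simp only [Finset.mem_Ico] at hx
    obtain ⟨V, hV, hxV⟩ := hP.cover x (by simp; omega)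
    refine ⟨V, Finset.mem_filter.2 ⟨hV, ?_⟩, hxV⟩
    by_contra hn
    rcases block_of_isSecond hP hi hai hV hn with ⟨-, -, h⟩ | ⟨-, -, h⟩ <;>
      · have := h x hxV; omega
  · exact fun V hV W hW => hP.eq_of_mem V (hsub V hV) W (hsub W hW)
  · exact fun V hV W hW => hP.noncrossing V (hsub V hV) W (hsub W hW)

theorem isNCPartition_outerPart {a i b : ℕ} (hai : a < i) {P : Finset (Finset ℕ)}
    (hP : IsNCPartition (Finset.Ico a b) P) (hi : IsSecond a i P) :
    IsNCPartition (Finset.Ico i b) (outerPart a i P) := by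
  have hmem : ∀ V, V ∈ outerPart a i P ↔
      ∃ U ∈ P, ¬ U ⊆ Finset.Ico (a + 1) i ∧ U.erase a = V := by
    intro V; simp [outerPart, and_assoc]
  constructor
  · intro V hV
    obtain ⟨U, hU, hn, rfl⟩ := (hmem V).1 hV
    rcases block_of_isSecond hP hi hai hU hn with ⟨-, h, -⟩ | ⟨h, -, -⟩
    · exact ⟨i, Finset.mem_erase.2 ⟨by omega, h⟩⟩
    · rw [Finset.erase_eq_of_notMem h]; exact hP.nonempty U hU
  · intro V hV x hx
    obtain ⟨U, hU, hn, rfl⟩ := (hmem V).1 hV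
    obtain ⟨hxa, hxU⟩ := Finset.mem_erase.1 hx
    have h1 := hP.subset U hU hxU
    simp only [Finset.mem_Ico] at h1 ⊢
    rcases block_of_isSecond hP hi hai hU hn with ⟨-, -, h⟩ | ⟨-, -, h⟩ <;>
      · have := h x hxU; omega
  · intro x hx
    simp only [Finset.mem_Ico] at hx
    obtain ⟨V, hV, hxV⟩ := hP.cover x (by simp; omega)
    refine ⟨V.erase a, (hmem _).2 ⟨V, hV, fun h => ?_, rfl⟩, Finset.mem_erase.2 ⟨by omega, hxV⟩⟩
    have := h hxV; simp at this; omega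
  · intro V hV W hW x hxV hxW
    obtain ⟨U, hU, -, rfl⟩ := (hmem V).1 hV
    obtain ⟨U', hU', -, rfl⟩ := (hmem W).1 hW
    rw [hP.eq_of_mem U hU U' hU' x (Finset.mem_of_mem_erase hxV) (Finset.mem_of_mem_erase hxW)]
  · intro V hV W hW p q r s hpq hqr hrs hp hr hq hs
    obtain ⟨U, hU, -, rfl⟩ := (hmem V).1 hV
    obtain ⟨U', hU', -, rfl⟩ := (hmem W).1 hW
    rw [hP.noncrossing U hU U' hU' p q r s hpq hqr hrs (Finset.mem_of_mem_erase hp)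
      (Finset.mem_of_mem_erase hr) (Finset.mem_of_mem_erase hq) (Finset.mem_of_mem_erase hs)]

theorem glue_parts {a i b : ℕ} (hai : a < i) {P : Finset (Finset ℕ)}
    (hP : IsNCPartition (Finset.Ico a b) P) (hi : IsSecond a i P) :
    glue a i (innerPart a i P, outerPart a i P) = P := by
  have key : (outerPart a i P).image (enlarge a i) = P.filter (¬ · ⊆ Finset.Ico (a + 1) i) := by
    rw [outerPart, Finset.image_image]
    conv_rhs => rw [← Finset.image_id (s := P.filter (¬ · ⊆ Finset.Ico (a + 1) i))]
    refine Finset.image_congr fun V hV => ?_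
    obtain ⟨hV, hn⟩ := Finset.mem_filter.1 hV
    simp only [Function.comp, id, enlarge, Finset.mem_erase]
    rcases block_of_isSecond hP hi hai hV hn with ⟨h, h', -⟩ | ⟨h, h', -⟩
    · rw [if_pos ⟨by omega, h'⟩, Finset.insert_erase h]
    · rw [if_neg fun h => h' h.2, Finset.erase_eq_of_notMem h]
  rw [glue, key, innerPart]
  exact Finset.filter_union_filter_not_eq _ _

theorem not_enlarge_subset {a i b : ℕ} {S : Finset (Finset ℕ)}
    (hS : IsNCPartition (Finset.Ico i b) S) {V : Finset ℕ} (hV : V ∈ S) :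
    ¬ enlarge a i V ⊆ Finset.Ico (a + 1) i := by
  intro h
  obtain ⟨x, hx⟩ := hS.nonempty V hV
  have h1 := h (mem_enlarge.2 (Or.inl hx))
  have h2 := hS.subset V hV hx
  simp at h1 h2; omega

theorem innerPart_glue {a i b : ℕ} {Q S : Finset (Finset ℕ)}
    (hQ : IsNCPartition (Finset.Ico (a + 1) i) Q) (hS : IsNCPartition (Finset.Ico i b) S) :
    innerPart a i (glue a i (Q, S)) = Q := by
  rw [innerPart, glue, Finset.filter_union, Finset.filter_true_of_mem hQ.subset,
    Finset.filter_false_of_mem, Finset.union_empty]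
  intro V hV
  obtain ⟨U, hU, rfl⟩ := Finset.mem_image.1 hV
  exact not_enlarge_subset hS hU

theorem outerPart_glue {a i b : ℕ} (hai : a < i) {Q S : Finset (Finset ℕ)}
    (hQ : IsNCPartition (Finset.Ico (a + 1) i) Q) (hS : IsNCPartition (Finset.Ico i b) S) :
    outerPart a i (glue a i (Q, S)) = S := by
  rw [outerPart, glue, Finset.filter_union, Finset.filter_false_of_mem,
    Finset.filter_true_of_mem, Finset.empty_union, Finset.image_image]
  · conv_rhs => rw [← Finset.image_id (s := S)]
    refine Finset.image_congr fun V hV => ?_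
    refine enlarge_erase fun h => ?_
    have := hS.subset V hV h; simp at this; omega
  · intro V hV
    obtain ⟨U, hU, rfl⟩ := Finset.mem_image.1 hV
    exact not_enlarge_subset hS hU
  · intro V hV h
    exact h (hQ.subset V hV)

theorem ncWeight_glue (k : ℕ → ℝ) (j : ℕ) {a i b : ℕ} (hai : a < i) {Q S : Finset (Finset ℕ)}
    (hQ : IsNCPartition (Finset.Ico (a + 1) i) Q) (hS : IsNCPartition (Finset.Ico i b) S) :
    ncWeight k j a (glue a i (Q, S)) = ncWeight k 0 (a + 1) Q * ncWeight k (j + 1) i S := by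
  have haS : ∀ V ∈ S, a ∉ V := fun V hV h => by
    have := hS.subset V hV h; simp at this; omega
  rw [ncWeight, glue, Finset.prod_union, Finset.prod_image, ncWeight_zero, ncWeight]
  · congr 1
    · refine Finset.prod_congr rfl fun V hV => ?_
      rw [if_neg, add_zero]
      intro h
      have := hQ.subset V hV h; simp at this
    · refine Finset.prod_congr rfl fun V hV => ?_
      by_cases h : i ∈ V
      · simp only [enlarge, h, if_true, Finset.mem_insert, true_or,
          Finset.card_insert_of_notMem (haS V hV)]
        congr 1; ring
      · simp [enlarge, h, haS V hV]
  · intro V hV W hW h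
    rw [← enlarge_erase (haS V hV), ← enlarge_erase (haS W hW), h]
  · rw [Finset.disjoint_left]
    intro V hV hV'
    obtain ⟨U, hU, rfl⟩ := Finset.mem_image.1 hV'
    exact not_enlarge_subset hS hU (hQ.subset _ hV)

open Classical in
theorem sum_ncWeight_isSecond (k : ℕ → ℝ) (j : ℕ) {a i b : ℕ} (hai : a < i) (hib : i < b) :
    ∑ P ∈ ncPartitions (Finset.Ico a b) with IsSecond a i P, ncWeight k j a P =
      ncSum k 0 (a + 1) i * ncSum k (j + 1) i b := by
  rw [ncSum, ncSum, Finset.sum_mul_sum, ← Finset.sum_product']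
  symm
  refine Finset.sum_nbij' (glue a i) (fun P => (innerPart a i P, outerPart a i P)) ?_ ?_ ?_ ?_ ?_
  · rintro ⟨Q, S⟩ h
    simp only [Finset.mem_product, Finset.mem_filter, mem_ncPartitions] at h ⊢
    exact ⟨isNCPartition_glue hai hib h.1 h.2, isSecond_glue hib h.2⟩
  · intro P h
    simp only [Finset.mem_product, Finset.mem_filter, mem_ncPartitions] at h ⊢
    exact ⟨isNCPartition_innerPart hai hib h.1 h.2, isNCPartition_outerPart hai h.1 h.2⟩
  · rintro ⟨Q, S⟩ h
    simp only [Finset.mem_product, mem_ncPartitions] at h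
    simp only [innerPart_glue h.1 h.2, outerPart_glue hai h.1 h.2]
  · intro P h
    simp only [Finset.mem_filter, mem_ncPartitions] at h
    exact glue_parts hai h.1 h.2
  · rintro ⟨Q, S⟩ h
    simp only [Finset.mem_product, mem_ncPartitions] at h
    exact (ncWeight_glue k j hai h.1 h.2).symm

theorem ncSum_of_lt (k : ℕ → ℝ) (j : ℕ) {a b : ℕ} (hab : a < b) :
    ncSum k j a b = k (1 + j) * ncSum k 0 (a + 1) b +
      ∑ i ∈ Finset.Ioo a b, ncSum k 0 (a + 1) i * ncSum k (j + 1) i b := by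
  classical
  rw [← sum_ncWeight_singleton k j hab, ncSum,
    ← Finset.sum_filter_add_sum_filter_not _ (fun P => {a} ∈ P)]
  congr 1
  have hsum : ∀ i ∈ Finset.Ioo a b, ncSum k 0 (a + 1) i * ncSum k (j + 1) i b =
      ∑ P ∈ ncPartitions (Finset.Ico a b) with IsSecond a i P, ncWeight k j a P := by
    intro i hi
    rw [Finset.mem_Ioo] at hi
    exact (sum_ncWeight_isSecond k j hi.1 hi.2).symm
  rw [Finset.sum_congr rfl hsum, ← Finset.sum_biUnion]
  · refine Finset.sum_congr ?_ fun _ _ => rfl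
    ext P
    simp only [Finset.mem_filter, Finset.mem_biUnion, mem_ncPartitions, Finset.mem_Ioo]
    constructor
    · rintro ⟨hP, ha⟩
      obtain ⟨V, hV, haV⟩ := hP.cover a (by simp [hab])
      have hne : (V.erase a).Nonempty := by
        rw [Finset.nonempty_iff_ne_empty]
        intro h
        rcases (Finset.erase_eq_empty_iff _ _).1 h with h | h
        · simp [h] at haV
        · exact ha (h ▸ hV)
      have hm := Finset.min'_mem _ hne
      set i := (V.erase a).min' hne with hidef
      have hmem := Finset.mem_erase.1 hm
      have := hP.subset V hV hmem.2
      simp only [Finset.mem_Ico] at this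
      refine ⟨i, by omega, hP, V, hV, haV, hmem.2, fun x hx => ?_⟩
      by_cases hxa : x = a
      · exact Or.inl hxa
      · exact Or.inr (Finset.min'_le _ _ (Finset.mem_erase.2 ⟨hxa, hx⟩))
    · rintro ⟨i, hi, hP, V, hV, haV, hiV, hx⟩
      refine ⟨hP, fun h => ?_⟩
      have := hP.eq_of_mem V hV _ h a haV (by simp)
      subst this
      simp at hiV; omega
  · intro i hi i' hi' hne
    simp only [Finset.coe_Ioo, Set.mem_Ioo] at hi hi'
    refine Finset.disjoint_left.2 fun P hP hP' => ?_
    simp only [Finset.mem_filter, mem_ncPartitions] at hP hP'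
    obtain ⟨hP, V, hV, haV, hiV, hx⟩ := hP
    obtain ⟨-, W, hW, haW, hiW, hx'⟩ := hP'
    obtain rfl := hP.eq_of_mem V hV W hW a haV haW
    have := hx i' hiW
    have := hx' i hiV
    omega

theorem ncSum_shift (k : ℕ → ℝ) (n : ℕ) : ∀ j a, ncSum k j a (a + n) = ncSum k j 0 n := by
  induction n using Nat.strong_induction_on with
  | _ n ih =>
    intro j a
    rcases Nat.eq_zero_or_pos n with rfl | hn
    · simp [ncSum_self]
    obtain ⟨n, rfl⟩ : ∃ r, n = r + 1 := ⟨n - 1, by omega⟩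
    rw [ncSum_of_lt k j (by omega : a < a + (n + 1)), ncSum_of_lt k j (by omega : 0 < n + 1)]
    have h1 := ih n (by omega) 0 (a + 1)
    have h2 := ih n (by omega) 0 1
    rw [show a + (n + 1) = a + 1 + n by ring, h1, show 0 + 1 = 1 from rfl,
      show n + 1 = 1 + n by ring, h2]
    congr 1
    symm
    refine Finset.sum_bij' (fun i _ => a + i) (fun i _ => i - a) ?_ ?_ ?_ ?_ ?_
    · intro i hi; simp only [Finset.mem_Ioo] at hi ⊢; omega
    · intro i hi; simp only [Finset.mem_Ioo] at hi ⊢; omega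
    · intro i hi; simp
    · intro i hi; simp only [Finset.mem_Ioo] at hi ⊢; omega
    · intro i hi
      simp only [Finset.mem_Ioo] at hi
      obtain ⟨r, rfl⟩ : ∃ r, i = 1 + r := ⟨i - 1, by omega⟩
      obtain ⟨q, rfl⟩ : ∃ q, n = r + q := ⟨n - r, by omega⟩
      rw [ih r (by omega) 0 1, show a + (1 + r) = a + 1 + r by ring, ih r (by omega) 0 (a + 1),
        show 1 + (r + q) = 1 + r + q by ring, show a + 1 + (r + q) = a + 1 + r + q by ring,
        ih q (by omega), ih q (by omega)]

theorem ncSum_succ (k : ℕ → ℝ) (j n : ℕ) :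
    ncSum k j 0 (n + 1) = k (1 + j) * ncSum k 0 0 n +
      ∑ x ∈ Finset.HasAntidiagonal.antidiagonal n with x.2 ≠ 0, ncSum k 0 0 x.1 * ncSum k (j + 1) 0 x.2 := by
  rw [ncSum_of_lt k j (by omega : 0 < n + 1), add_comm n 1, ncSum_shift]
  congr 1
  refine Finset.sum_bij' (fun i _ => (i - 1, n + 1 - i)) (fun x _ => x.1 + 1) ?_ ?_ ?_ ?_ ?_
  · intro i hi; simp only [Finset.mem_Ioo] at hi; simp; omega
  · rintro ⟨x, y⟩ hx; simp at hx ⊢; omega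
  · intro i hi; simp only [Finset.mem_Ioo] at hi; simp; omega
  · rintro ⟨x, y⟩ hx; simp at hx ⊢; omega
  · intro i hi
    simp only [Finset.mem_Ioo] at hi
    obtain ⟨r, rfl⟩ : ∃ r, i = 1 + r := ⟨i - 1, by omega⟩
    obtain ⟨q, rfl⟩ : ∃ q, n = r + q := ⟨n - r, by omega⟩
    rw [show 1 + (r + q) = 1 + r + q by ring, ncSum_shift, ncSum_shift]
    congr 2 <;> omega

/-- The sum over `NC(n)` in terms of sets of blocks of natural numbers. -/
theorem sum_NC_eq_ncSum (k : ℕ → ℝ) (n : ℕ) :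
    ∑ π ∈ NC n, ∏ V ∈ π.parts, k V.card = ncSum k 0 0 n := by
  classical
  simp only [ncSum, ncWeight_zero]
  refine Finset.sum_bij (fun π _ => π.parts.image (fun V => V.map Fin.valEmbedding)) ?_ ?_ ?_ ?_
  · intro π hπ
    have hnc : IsNonCrossing π := (Finset.mem_filter.1 hπ).2
    rw [mem_ncPartitions]
    have hmem : ∀ V, V ∈ π.parts.image (fun V => V.map Fin.valEmbedding) ↔
      ∃ U ∈ π.parts, U.map Fin.valEmbedding = V := fun V => Finset.mem_image
    constructor
    · intro V hV
      obtain ⟨U, hU, rfl⟩ := (hmem V).1 hV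
      exact (π.nonempty_of_mem_parts hU).map
    · intro V hV x hx
      obtain ⟨U, hU, rfl⟩ := (hmem V).1 hV
      obtain ⟨y, -, rfl⟩ := Finset.mem_map.1 hx
      simp
    · intro x hx
      simp only [Finset.mem_Ico] at hx
      obtain ⟨U, hU, hxU⟩ := π.exists_mem (Finset.mem_univ (⟨x, hx.2⟩ : Fin n))
      exact ⟨_, (hmem _).2 ⟨U, hU, rfl⟩, Finset.mem_map.2 ⟨_, hxU, rfl⟩⟩
    · intro V hV W hW x hxV hxW
      obtain ⟨U, hU, rfl⟩ := (hmem V).1 hV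
      obtain ⟨U', hU', rfl⟩ := (hmem W).1 hW
      obtain ⟨y, hy, rfl⟩ := Finset.mem_map.1 hxV
      obtain ⟨y', hy', h⟩ := Finset.mem_map.1 hxW
      rw [Fin.valEmbedding.injective h] at hy'
      rw [π.eq_of_mem_parts hU hU' hy hy']
    · intro V hV W hW a b c d hab hbc hcd ha hc hb hd
      obtain ⟨U, hU, rfl⟩ := (hmem V).1 hV
      obtain ⟨U', hU', rfl⟩ := (hmem W).1 hW
      obtain ⟨a, ha', rfl⟩ := Finset.mem_map.1 ha
      obtain ⟨b, hb', rfl⟩ := Finset.mem_map.1 hb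
      obtain ⟨c, hc', rfl⟩ := Finset.mem_map.1 hc
      obtain ⟨d, hd', rfl⟩ := Finset.mem_map.1 hd
      by_contra hne
      exact hnc U hU U' hU' (fun h => hne (by rw [h]))
        ⟨a, b, c, d, hab, hbc, hcd, ha', hc', hb', hd'⟩
  · intro π _ ρ _ h
    exact Finpartition.ext (Finset.image_injective (Finset.map_injective _) h)
  · intro P hP
    rw [mem_ncPartitions] at hP
    set f : Finset ℕ → Finset (Fin n) := fun V => Finset.univ.filter fun x => (x : ℕ) ∈ V with hf
    have hfm : ∀ V ∈ P, (f V).map Fin.valEmbedding = V := by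
      intro V hV
      ext x
      simp only [hf, Finset.mem_map, Finset.mem_filter, Finset.mem_univ, true_and]
      constructor
      · rintro ⟨y, hy, rfl⟩; exact hy
      · intro hx
        have := hP.subset V hV hx
        simp only [Finset.mem_Ico] at this
        exact ⟨⟨x, this.2⟩, hx, rfl⟩
    refine ⟨Finpartition.ofExistsUnique (P.image f) (fun _ _ => Finset.subset_univ _) ?_ ?_, ?_, ?_⟩
    · intro x _
      obtain ⟨V, hV, hxV⟩ := hP.cover x (by simp)
      refine ⟨f V, ⟨Finset.mem_image_of_mem _ hV, by simpa [hf] using hxV⟩, ?_⟩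
      rintro W ⟨hW, hxW⟩
      obtain ⟨U, hU, rfl⟩ := Finset.mem_image.1 hW
      rw [hP.eq_of_mem V hV U hU x hxV (by simpa [hf] using hxW)]
    · intro h
      obtain ⟨U, hU, hU'⟩ := Finset.mem_image.1 h
      have := hfm U hU
      rw [hU', Finset.map_empty] at this
      exact (hP.nonempty U hU).ne_empty this.symm
    · simp only [NC, Finset.mem_filter, Finset.mem_univ, true_and]
      intro V hV W hW hne
      simp only [Finpartition.ofExistsUnique] at hV hW
      obtain ⟨U, hU, rfl⟩ := Finset.mem_image.1 hV
      obtain ⟨U', hU', rfl⟩ := Finset.mem_image.1 hW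
      rintro ⟨a, b, c, d, hab, hbc, hcd, ha, hc, hb, hd⟩
      simp only [hf, Finset.mem_filter, Finset.mem_univ, true_and] at ha hb hc hd
      exact hne (by rw [hP.noncrossing U hU U' hU' a b c d hab hbc hcd ha hc hb hd])
    · simp only [Finpartition.ofExistsUnique, Finset.image_image]
      conv_rhs => rw [← Finset.image_id (s := P)]
      exact Finset.image_congr fun V hV => hfm V hV
  · intro π _
    rw [Finset.prod_image fun V _ W _ h => Finset.map_injective _ h]
    simp

open PowerSeries in
theorem ncSum_powerSeries (k : ℕ → ℝ) (j : ℕ) :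
    (mk fun n => if n = 0 then 0 else ncSum k j 0 n : PowerSeries ℝ) =
      X * mk (ncSum k 0 0) *
        (C (k (1 + j)) + mk fun n => if n = 0 then 0 else ncSum k (j + 1) 0 n) := by
  ext n
  rcases n with _ | n
  · simp [mul_assoc]
  rw [mul_assoc, coeff_succ_X_mul, mul_add, map_add, mul_comm _ (C _), coeff_C_mul, coeff_mul]
  simp only [coeff_mk, Nat.succ_ne_zero, if_false, ncSum_succ, Finset.sum_filter]
  congr 1
  refine Finset.sum_congr rfl fun x _ => ?_
  by_cases h : x.2 = 0 <;> simp [h]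

open PowerSeries in
theorem ncSum_powerSeries_iterate (k : ℕ → ℝ) (N : ℕ) :
    (mk fun n => if n = 0 then 0 else ncSum k 0 0 n : PowerSeries ℝ) =
      ∑ s ∈ Finset.range N, C (k (s + 1)) * (X * mk (ncSum k 0 0)) ^ (s + 1) +
        (X * mk (ncSum k 0 0)) ^ N * mk fun n => if n = 0 then 0 else ncSum k N 0 n := by
  induction N with
  | zero => simp
  | succ N ih =>
    rw [ih, ncSum_powerSeries k N, Finset.sum_range_succ, add_comm 1 N]
    ring

open PowerSeries in
/-- The functional equation between moments and free cumulants, truncated at order `p`. -/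
theorem X_pow_dvd_moment_cumulant (m : ℕ → ℝ) (hm : m 0 = 1) (p : ℕ) :
    (Polynomial.X : Polynomial ℝ) ^ (p + 1) ∣ trunc (p + 1) (mk m) - 1 -
      ∑ s ∈ Finset.range p, Polynomial.C (cumulantOfMoments m (s + 1)) *
        (Polynomial.X * trunc (p + 1) (mk m)) ^ (s + 1) := by
  set k := cumulantOfMoments m with hk
  have hF : (mk (ncSum k 0 0) : PowerSeries ℝ) = mk m := by
    ext n
    rw [coeff_mk, coeff_mk]
    rcases Nat.eq_zero_or_pos n with rfl | hn
    · rw [ncSum_self, hm]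
    · rw [← sum_NC_eq_ncSum, moment_eq_sum_cumulant m hn]
  have hW : (mk fun n => if n = 0 then 0 else ncSum k 0 0 n : PowerSeries ℝ) = mk m - 1 := by
    rw [← hF]
    ext n
    by_cases h : n = 0 <;> simp [coeff_one, h, ncSum_self]
  have hT : (X : PowerSeries ℝ) ^ (p + 1) ∣ (trunc (p + 1) (mk m) : PowerSeries ℝ) - mk m := by
    rw [X_pow_dvd_iff]
    intro i hi
    simp [Polynomial.coeff_coe, coeff_trunc, hi]
  have hX : (X : PowerSeries ℝ) ∣ mk fun n => if n = 0 then 0 else ncSum k p 0 n := by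
    rw [X_dvd_iff]; simp
  have hiter := ncSum_powerSeries_iterate k p
  rw [hW, hF] at hiter
  have hPS : (X : PowerSeries ℝ) ^ (p + 1) ∣ (trunc (p + 1) (mk m) : PowerSeries ℝ) - 1 -
      ∑ s ∈ Finset.range p, C (k (s + 1)) * (X * (trunc (p + 1) (mk m) : PowerSeries ℝ)) ^ (s + 1) := by
    have h1 : (X : PowerSeries ℝ) ^ (p + 1) ∣
        (X * mk m) ^ p * mk fun n => if n = 0 then 0 else ncSum k p 0 n := by
      rw [pow_succ, mul_pow]
      exact mul_dvd_mul (dvd_mul_right _ _) hX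
    have h2 : (X : PowerSeries ℝ) ^ (p + 1) ∣ ∑ s ∈ Finset.range p, C (k (s + 1)) *
        ((X * (trunc (p + 1) (mk m) : PowerSeries ℝ)) ^ (s + 1) - (X * mk m) ^ (s + 1)) := by
      refine Finset.dvd_sum fun s _ => Dvd.dvd.mul_left (dvd_trans ?_ (sub_dvd_pow_sub_pow _ _ _)) _
      rw [← mul_sub]
      exact Dvd.dvd.mul_left hT _
    have : (trunc (p + 1) (mk m) : PowerSeries ℝ) - 1 - ∑ s ∈ Finset.range p,
        C (k (s + 1)) * (X * (trunc (p + 1) (mk m) : PowerSeries ℝ)) ^ (s + 1) =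
        ((trunc (p + 1) (mk m) : PowerSeries ℝ) - mk m) +
        (X * mk m) ^ p * (mk fun n => if n = 0 then 0 else ncSum k p 0 n) -
        ∑ s ∈ Finset.range p, C (k (s + 1)) *
        ((X * (trunc (p + 1) (mk m) : PowerSeries ℝ)) ^ (s + 1) - (X * mk m) ^ (s + 1)) := by
      simp only [mul_sub, Finset.sum_sub_distrib]
      linear_combination hiter
    rw [this]
    exact dvd_sub (dvd_add hT h1) h2
  rw [Polynomial.X_pow_dvd_iff]
  rw [X_pow_dvd_iff] at hPS
  intro d hd
  rw [← hPS d hd, ← Polynomial.coeff_coe]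
  congr 1
  rw [Polynomial.coe_sub, Polynomial.coe_sub, Polynomial.coe_one]
  congr 1
  rw [← Polynomial.coeToPowerSeries.ringHom_apply, map_sum]
  simp [Polynomial.coe_C, Polynomial.coe_X]

noncomputable section

/-- The infinite cone `{z = x + iy : |x| < -α y}`. -/
def lowerCone (α : ℝ) : Set ℂ := {z : ℂ | |z.re| < -(α * z.im)}

theorem truncCone_eq_inter (α β : ℝ) : truncCone α β = lowerCone α ∩ Metric.ball 0 β := by
  ext z; simp [truncCone, lowerCone]

theorem nhdsWithin_truncCone (α : ℝ) {β : ℝ} (hβ : 0 < β) :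
    𝓝[truncCone α β] (0 : ℂ) = 𝓝[lowerCone α] 0 := by
  rw [truncCone_eq_inter]
  exact nhdsWithin_inter_of_mem' (mem_nhdsWithin_of_mem_nhds (Metric.ball_mem_nhds 0 hβ))

theorem mem_nhdsWithin_lowerCone {α : ℝ} {s : Set ℂ} :
    s ∈ 𝓝[lowerCone α] (0 : ℂ) ↔ ∃ β : ℝ, 0 < β ∧ truncCone α β ⊆ s := by
  rw [Metric.mem_nhdsWithin_iff]
  simp only [truncCone_eq_inter, Set.inter_comm, gt_iff_lt]

theorem isOpen_lowerCone (α : ℝ) : IsOpen (lowerCone α) :=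
  isOpen_lt (by fun_prop) (by fun_prop)

theorem isOpen_truncCone (α β : ℝ) : IsOpen (truncCone α β) := by
  rw [truncCone_eq_inter]
  exact (isOpen_lowerCone α).inter Metric.isOpen_ball

theorem convex_truncCone (α β : ℝ) : Convex ℝ (truncCone α β) := by
  rw [truncCone_eq_inter]
  refine Convex.inter ?_ (convex_ball 0 β)
  intro z hz w hw a b ha hb hab
  simp only [lowerCone, Set.mem_ofPred_eq, abs_lt] at hz hw ⊢
  simp only [Complex.add_re, Complex.add_im, Complex.smul_re, Complex.smul_im, smul_eq_mul]
  rcases eq_or_lt_of_le ha with rfl | ha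
  · obtain rfl : b = 1 := by linarith
    constructor <;> nlinarith
  · have hb' := mul_le_mul_of_nonneg_left hw.1.le hb
    have hb'' := mul_le_mul_of_nonneg_left hw.2.le hb
    have h1 := mul_lt_mul_of_pos_left hz.1 ha
    have h2 := mul_lt_mul_of_pos_left hz.2 ha
    constructor <;> nlinarith

theorem truncCone_mono {α α' β β' : ℝ} (hα : 0 < α) (h : α ≤ α') (h' : β ≤ β') :
    truncCone α β ⊆ truncCone α' β' := by
  intro z hz
  refine ⟨?_, hz.2.trans_le h'⟩
  have h1 := hz.1
  have : z.im < 0 := by have := abs_nonneg z.re; by_contra! h0; nlinarith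
  nlinarith

theorem neg_I_mem_truncCone {α β s : ℝ} (hα : 0 < α) (hs : 0 < s) (hsβ : s < β) :
    (-(s * Complex.I) : ℂ) ∈ truncCone α β := by
  constructor
  · simp; positivity
  · simpa [abs_of_pos hs] using hsβ

section Cone

variable {α : ℝ} {z : ℂ}

theorem im_neg_of_mem_lowerCone (hα : 0 < α) (hz : z ∈ lowerCone α) : z.im < 0 := by
  have h1 : |z.re| < -(α * z.im) := hz
  have := abs_nonneg z.re
  by_contra! h0; nlinarith

theorem ne_zero_of_mem_lowerCone (hα : 0 < α) (hz : z ∈ lowerCone α) : z ≠ 0 := by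
  rintro rfl
  simpa using im_neg_of_mem_lowerCone hα hz

theorem norm_le_of_mem_lowerCone (hα : 0 < α) (hz : z ∈ lowerCone α) :
    ‖z‖ ≤ (1 + α) * -z.im := by
  have h1 : |z.re| < -(α * z.im) := hz
  have h2 := im_neg_of_mem_lowerCone hα hz
  have h3 := Complex.norm_le_abs_re_add_abs_im z
  rw [abs_of_neg h2] at h3
  linarith

theorem one_le_mul_norm_one_sub (hα : 0 < α) (hz : z ∈ lowerCone α) (t : ℝ) :
    1 ≤ (1 + α) * ‖1 - t * z‖ := by
  have h2 := im_neg_of_mem_lowerCone hα hz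
  have h3 := norm_le_of_mem_lowerCone hα hz
  have h4 : -z.im ≤ ‖z‖ * ‖1 - t * z‖ := by
    rw [← Complex.norm_conj z, ← norm_mul]
    refine le_trans ?_ (Complex.abs_im_le_norm _)
    refine le_trans (le_of_eq ?_) (le_abs_self _)
    simp
    ring
  have h5 : 0 ≤ ‖1 - t * z‖ := norm_nonneg _
  have h6 : -z.im * 1 ≤ -z.im * ((1 + α) * ‖1 - t * z‖) := by nlinarith
  exact le_of_mul_le_mul_left h6 (by linarith)

theorem one_sub_ne_zero_of_mem_lowerCone (hα : 0 < α) (hz : z ∈ lowerCone α) (t : ℝ) :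
    1 - t * z ≠ 0 := by
  intro h
  have := one_le_mul_norm_one_sub hα hz t
  rw [h, norm_zero] at this
  linarith

theorem norm_inv_one_sub_le (hα : 0 < α) (hz : z ∈ lowerCone α) (t : ℝ) :
    ‖(1 - t * z)⁻¹‖ ≤ 1 + α := by
  have h := one_le_mul_norm_one_sub hα hz t
  have h0 : 0 < ‖1 - t * z‖ := norm_pos_iff.2 (one_sub_ne_zero_of_mem_lowerCone hα hz t)
  rw [norm_inv, inv_le_iff_one_le_mul₀ h0]
  exact h

end Cone

theorem mem_truncCone_of_norm_sub_le {a a' b b' r : ℝ} {z u : ℂ} (ha : 0 < a) (ha' : 0 ≤ a')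
    (hr : 0 ≤ r) (hz : z ∈ truncCone a b) (hu : ‖u - z‖ ≤ r * ‖z‖)
    (h : r * ((1 + a) * (1 + a')) ≤ a' - a) (hb : (1 + r) * b ≤ b') : u ∈ truncCone a' b' := by
  have him := im_neg_of_mem_lowerCone ha hz.1
  have hn := norm_le_of_mem_lowerCone ha hz.1
  have h1 := hz.1
  have hre := (Complex.abs_re_le_norm (u - z)).trans hu
  have him' := (Complex.abs_im_le_norm (u - z)).trans hu
  rw [Complex.sub_re, abs_le] at hre
  rw [Complex.sub_im, abs_le] at him'
  have hd : r * ‖z‖ ≤ r * ((1 + a) * -z.im) := mul_le_mul_of_nonneg_left hn hr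
  have hd' : r * ‖z‖ * (1 + a') ≤ (a' - a) * -z.im := by
    calc r * ‖z‖ * (1 + a') ≤ r * ((1 + a) * -z.im) * (1 + a') := by gcongr
      _ = r * ((1 + a) * (1 + a')) * -z.im := by ring
      _ ≤ _ := by apply mul_le_mul_of_nonneg_right h; linarith
  have h2 := mul_le_mul_of_nonneg_left him'.2 ha'
  rw [abs_lt] at h1
  constructor
  · rw [abs_lt]; constructor <;> nlinarith
  · have h3 : ‖u‖ ≤ ‖u - z‖ + ‖z‖ := by simpa using norm_add_le (u - z) z
    have := hz.2
    nlinarith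

theorem margin_pos {α : ℝ} (hα : 0 < α) : 0 < margin α := by
  unfold margin; positivity

theorem margin_le_half (α : ℝ) : margin α ≤ 1 / 2 := by
  unfold margin; have := min_le_right α 1; linarith

theorem margin_le_self_div (α : ℝ) : margin α ≤ α / 2 := by
  unfold margin; have := min_le_left α 1; linarith

variable (μ : Measure ℝ)

/-- The function `z ↦ ∫ t^j / (1 - tz) dμ(t)`. -/
def resolventMoment (j : ℕ) (z : ℂ) : ℂ := ∫ t : ℝ, (t : ℂ) ^ j * (1 - t * z)⁻¹ ∂μ

theorem cauchyInv_eq {z : ℂ} (hz : z ≠ 0) : cauchyInv μ z = z * resolventMoment μ 0 z := by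
  rw [cauchyInv, cauchyTransform, resolventMoment, ← integral_const_mul]
  congr 1
  ext t
  rw [pow_zero, one_mul, show 1 / z - (t : ℂ) = (1 - t * z) / z by field_simp, one_div, inv_div,
    div_eq_mul_inv]

theorem tendsto_resolventMoment {j : ℕ} (hj : Integrable (fun t : ℝ => t ^ j) μ) {α : ℝ}
    (hα : 0 < α) : Tendsto (resolventMoment μ j) (𝓝[lowerCone α] 0)
      (𝓝 ((∫ t : ℝ, t ^ j ∂μ : ℝ) : ℂ)) := by
  have h0 : ((∫ t : ℝ, t ^ j ∂μ : ℝ) : ℂ) = ∫ t : ℝ, (t : ℂ) ^ j ∂μ := by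
    rw [← integral_complex_ofReal]; simp
  rw [h0]
  refine tendsto_integral_filter_of_dominated_convergence (fun t => |t ^ j| * (1 + α)) ?_ ?_ ?_ ?_
  · exact Eventually.of_forall fun z => (by fun_prop : Measurable _).aestronglyMeasurable
  · filter_upwards [self_mem_nhdsWithin] with z hz
    refine Eventually.of_forall fun t => ?_
    rw [norm_mul, ← Complex.ofReal_pow, Complex.norm_real, Real.norm_eq_abs]
    exact mul_le_mul_of_nonneg_left (norm_inv_one_sub_le hα hz t) (abs_nonneg _)
  · exact hj.abs.mul_const _
  · refine Eventually.of_forall fun t => tendsto_nhdsWithin_of_tendsto_nhds ?_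
    have : ContinuousAt (fun z : ℂ => (t : ℂ) ^ j * (1 - t * z)⁻¹) 0 :=
      ContinuousAt.mul (by fun_prop) (ContinuousAt.inv₀ (by fun_prop) (by simp))
    simpa [ContinuousAt] using this

variable [IsProbabilityMeasure μ]

theorem integrable_inv_one_sub {α : ℝ} (hα : 0 < α) {z : ℂ} (hz : z ∈ lowerCone α) :
    Integrable (fun t : ℝ => (1 - t * z)⁻¹) μ :=
  Integrable.of_bound (C := 1 + α) (by fun_prop : Measurable _).aestronglyMeasurable
    (Eventually.of_forall fun t => norm_inv_one_sub_le hα hz t)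

/-- The kernel of the divided differences of `z ↦ G_μ(1/z)`. -/
def divDiff (z w : ℂ) : ℂ := ∫ t : ℝ, (1 - t * z)⁻¹ * (1 - t * w)⁻¹ ∂μ

theorem cauchyInv_sub {α : ℝ} (hα : 0 < α) {z w : ℂ} (hz : z ∈ lowerCone α)
    (hw : w ∈ lowerCone α) : cauchyInv μ z - cauchyInv μ w = (z - w) * divDiff μ z w := by
  rw [cauchyInv_eq μ (ne_zero_of_mem_lowerCone hα hz),
    cauchyInv_eq μ (ne_zero_of_mem_lowerCone hα hw), divDiff, resolventMoment, resolventMoment]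
  simp only [pow_zero, one_mul]
  rw [← integral_const_mul, ← integral_const_mul, ← integral_const_mul, ← integral_sub
    ((integrable_inv_one_sub μ hα hz).const_mul _) ((integrable_inv_one_sub μ hα hw).const_mul _)]
  congr 1
  ext t
  have h1 := one_sub_ne_zero_of_mem_lowerCone hα hz t
  have h2 := one_sub_ne_zero_of_mem_lowerCone hα hw t
  have h3 := mul_inv_cancel₀ h1
  have h4 := mul_inv_cancel₀ h2
  linear_combination (w * (1 - t * w)⁻¹) * h3 - (z * (1 - t * z)⁻¹) * h4

theorem tendsto_divDiff {ι : Type*} {l : Filter ι} [l.IsCountablyGenerated] {u v : ι → ℂ} {z : ℂ}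
    {α : ℝ} (hα : 0 < α) (hu : ∀ᶠ i in l, u i ∈ lowerCone α) (hv : ∀ᶠ i in l, v i ∈ lowerCone α)
    (huz : Tendsto u l (𝓝 z)) (hvz : Tendsto v l (𝓝 z)) (hz : ∀ t : ℝ, 1 - t * z ≠ 0) :
    Tendsto (fun i => divDiff μ (u i) (v i)) l (𝓝 (divDiff μ z z)) := by
  refine tendsto_integral_filter_of_dominated_convergence (fun _ => (1 + α) * (1 + α)) ?_ ?_ ?_ ?_
  · exact Eventually.of_forall fun z => (by fun_prop : Measurable _).aestronglyMeasurable
  · filter_upwards [hu, hv] with i hi hi'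
    refine Eventually.of_forall fun t => ?_
    rw [norm_mul]
    exact mul_le_mul (norm_inv_one_sub_le hα hi t) (norm_inv_one_sub_le hα hi' t)
      (norm_nonneg _) (by linarith)
  · exact integrable_const _
  · refine Eventually.of_forall fun t => ?_
    exact ((huz.const_mul _).const_sub _ |>.inv₀ (hz t)).mul
      ((hvz.const_mul _).const_sub _ |>.inv₀ (hz t))

theorem exists_cauchyInv_near_id {α δ : ℝ} (hα : 0 < α) (hδ : 0 < δ) : ∃ β : ℝ, 0 < β ∧
    ∀ z ∈ truncCone α β, ‖cauchyInv μ z - z‖ ≤ δ * ‖z‖ ∧ ∀ w ∈ truncCone α β,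
      ‖cauchyInv μ z - cauchyInv μ w - (z - w)‖ ≤ δ * ‖z - w‖ := by
  have h1 : ∀ᶠ z in 𝓝[lowerCone α] (0 : ℂ), ‖resolventMoment μ 0 z - 1‖ < δ := by
    have := tendsto_resolventMoment μ (j := 0) (by simp) hα
    simp only [pow_zero, integral_const, probReal_univ, smul_eq_mul, mul_one,
      Complex.ofReal_one] at this
    simpa [dist_eq_norm] using this.eventually (Metric.ball_mem_nhds _ hδ)
  have h2 : ∀ᶠ x in 𝓝[lowerCone α] (0 : ℂ) ×ˢ 𝓝[lowerCone α] (0 : ℂ),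
      ‖divDiff μ x.1 x.2 - 1‖ < δ := by
    have := tendsto_divDiff μ (l := 𝓝[lowerCone α] (0 : ℂ) ×ˢ 𝓝[lowerCone α] (0 : ℂ))
      (u := Prod.fst) (v := Prod.snd) (z := 0) hα
      (tendsto_fst.eventually self_mem_nhdsWithin) (tendsto_snd.eventually self_mem_nhdsWithin)
      (tendsto_fst.mono_right nhdsWithin_le_nhds) (tendsto_snd.mono_right nhdsWithin_le_nhds)
      (by simp)
    have h0 : divDiff μ 0 0 = 1 := by simp [divDiff]
    rw [h0] at this
    simpa [dist_eq_norm] using this.eventually (Metric.ball_mem_nhds _ hδ)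
  obtain ⟨t, ht, htt⟩ := (eventually_prod_self_iff (r := fun z w => ‖divDiff μ z w - 1‖ < δ)).1 h2
  obtain ⟨β, hβ, hsub⟩ := mem_nhdsWithin_lowerCone.1 (inter_mem h1 ht)
  refine ⟨β, hβ, fun z hz => ⟨?_, fun w hw => ?_⟩⟩
  · rw [cauchyInv_eq μ (ne_zero_of_mem_lowerCone hα hz.1),
      show z * resolventMoment μ 0 z - z = (resolventMoment μ 0 z - 1) * z by ring, norm_mul]
    exact mul_le_mul_of_nonneg_right (hsub hz).1.le (norm_nonneg _)
  · rw [cauchyInv_sub μ hα hz.1 hw.1,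
      show (z - w) * divDiff μ z w - (z - w) = (divDiff μ z w - 1) * (z - w) by ring, norm_mul]
    exact mul_le_mul_of_nonneg_right (htt z (hsub hz).2 w (hsub hw).2).le (norm_nonneg _)

/-- A perturbation of the identity by a contraction reaches all points of a smaller set. -/
theorem exists_eq_of_norm_sub_le {g : ℂ → ℂ} {w : ℂ} {r δ : ℝ} (hr : 0 ≤ r) (hδ : 0 ≤ δ)
    (hδ1 : δ < 1) (hw : ‖g w - w‖ ≤ (1 - δ) * r)
    (hg : ∀ z ∈ Metric.closedBall w r, ∀ z' ∈ Metric.closedBall w r,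
      ‖g z - g z' - (z - z')‖ ≤ δ * ‖z - z'‖) : ∃ z ∈ Metric.closedBall w r, g z = w := by
  set T : ℂ → ℂ := fun z => z - g z + w with hT
  have hwm : w ∈ Metric.closedBall w r := Metric.mem_closedBall_self hr
  have hmaps : Set.MapsTo T (Metric.closedBall w r) (Metric.closedBall w r) := by
    intro z hz
    rw [Metric.mem_closedBall, dist_eq_norm] at hz ⊢
    have h1 := hg z (by rwa [Metric.mem_closedBall, dist_eq_norm]) w hwm
    calc ‖T z - w‖ = ‖-(g z - g w - (z - w)) + -(g w - w)‖ := by rw [hT]; congr 1; ring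
      _ ≤ ‖g z - g w - (z - w)‖ + ‖g w - w‖ := by
        refine (norm_add_le _ _).trans ?_
        rw [norm_neg, norm_neg]
      _ ≤ δ * r + (1 - δ) * r := by
        refine add_le_add (h1.trans ?_) hw
        exact mul_le_mul_of_nonneg_left hz hδ
      _ = r := by ring
  have hcontr : ContractingWith ⟨δ, hδ⟩ (hmaps.restrict T _ _) := by
    refine ⟨by exact_mod_cast hδ1, LipschitzWith.of_dist_le_mul ?_⟩
    rintro ⟨z, hz⟩ ⟨z', hz'⟩
    simp only [Subtype.dist_eq, Set.MapsTo.val_restrict_apply, dist_eq_norm]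
    rw [show T z - T z' = -(g z - g z' - (z - z')) by rw [hT]; ring, norm_neg]
    exact hg z hz z' hz'
  obtain ⟨z, hz, hfix, -⟩ := hcontr.exists_fixedPoint' Metric.isClosed_closedBall.isComplete hmaps
    hwm (edist_ne_top _ _)
  refine ⟨z, hz, ?_⟩
  have : z - g z + w = z := hfix
  linear_combination -this

/-- For every aperture there are small radii which are good and for which `z ↦ G_μ(1/z)` is close
to the identity. -/
theorem exists_isGood {α : ℝ} (hα : 0 < α) : ∃ β : ℝ, IsGood μ α β ∧
    ∀ z ∈ truncCone α β, ‖cauchyInv μ z - z‖ ≤ 1 / 2 * ‖z‖ ∧ ∀ w ∈ truncCone α β,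
      ‖cauchyInv μ z - cauchyInv μ w - (z - w)‖ ≤ 1 / 2 * ‖z - w‖ := by
  have he := margin_pos hα
  have he1 := margin_le_half α
  have he2 := margin_le_self_div α
  set e := margin α with hedef
  set r := e / ((1 + α) * (2 + α)) with hrdef
  have hden : (1 : ℝ) ≤ (1 + α) * (2 + α) := by nlinarith
  have hr : 0 < r := by positivity
  have hre : r ≤ e := div_le_self he.le hden
  have hrmul : r * ((1 + α) * (2 + α)) = e := div_mul_cancel₀ _ (by positivity)
  obtain ⟨β, hβ, h⟩ := exists_cauchyInv_near_id μ hα (half_pos hr)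
  refine ⟨β, ⟨hα, hβ, ?_⟩, ?_⟩
  · intro β' hβ' hle
    have hsub : truncCone α β' ⊆ truncCone α β := truncCone_mono hα le_rfl hle
    refine ⟨?_, ?_, ?_⟩
    · intro z hz w hw hzw
      have := (h z (hsub hz)).2 w (hsub hw)
      rw [hzw, sub_self, zero_sub, norm_neg] at this
      have h0 := norm_nonneg (z - w)
      have : ‖z - w‖ = 0 := by nlinarith
      exact sub_eq_zero.1 (norm_eq_zero.1 this)
    · intro w hw
      have hball : ∀ z ∈ Metric.closedBall w (r * ‖w‖), z ∈ truncCone α β' := by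
        intro z hz
        rw [Metric.mem_closedBall, dist_eq_norm] at hz
        refine mem_truncCone_of_norm_sub_le (by linarith) hα.le hr.le hw hz ?_ ?_
        · rw [← hedef]
          calc r * ((1 + (α - e)) * (1 + α)) ≤ r * ((2 + α) * (1 + α)) := by
                gcongr ?_ * (?_ * _); linarith
            _ = α - (α - e) := by rw [mul_comm (2 + α), hrmul]; ring
        · rw [← hedef]
          have : (1 + r) * (1 - e) ≤ 1 := by nlinarith
          nlinarith
      have hw0 := norm_nonneg w
      have hwm : w ∈ truncCone α β := hsub (hball w (Metric.mem_closedBall_self (by positivity)))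
      obtain ⟨z, hz, hzw⟩ := exists_eq_of_norm_sub_le (g := cauchyInv μ) (w := w) (r := r * ‖w‖)
        (δ := r / 2) (by positivity) (by positivity) (by linarith)
        ((h w hwm).1.trans (by
          rw [← mul_assoc]
          refine mul_le_mul_of_nonneg_right ?_ hw0
          nlinarith))
        (fun z hz z' hz' => (h z (hsub (hball z hz))).2 z' (hsub (hball z' hz')))
      exact ⟨z, hball z hz, hzw⟩
    · rintro _ ⟨z, hz, rfl⟩
      refine mem_truncCone_of_norm_sub_le hα (by linarith) hr.le hz
        ((h z (hsub hz)).1.trans ?_) ?_ ?_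
      · exact mul_le_mul_of_nonneg_right (by linarith) (norm_nonneg _)
      · calc r * ((1 + α) * (1 + (α + margin α))) ≤ r * ((1 + α) * (2 + α)) := by
              gcongr ?_ * (_ * ?_); linarith
          _ = _ := by rw [hrmul]; ring
      · exact mul_le_mul_of_nonneg_right (by linarith) hβ'.le
  · intro z hz
    refine ⟨(h z hz).1.trans ?_, fun w hw => ((h z hz).2 w hw).trans ?_⟩ <;>
      exact mul_le_mul_of_nonneg_right (by linarith) (norm_nonneg _)

omit [IsProbabilityMeasure μ] in
variable {μ} in
theorem inverseL_spec {α β : ℝ} (h : IsGood μ α β) {w : ℂ}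
    (hw : w ∈ truncCone (α - margin α) ((1 - margin α) * β)) :
    inverseL μ w ∈ truncCone α β ∧ cauchyInv μ (inverseL μ w) = w := by
  obtain ⟨z, hz, hzw⟩ := (h.2.2 β h.2.1 le_rfl).2.1 hw
  rw [inverseL_eq ⟨α, β, h, hw, hz, hzw⟩]
  exact ⟨hz, hzw⟩

theorem hasDerivAt_cauchyInv {α : ℝ} (hα : 0 < α) {z : ℂ} (hz : z ∈ lowerCone α) :
    HasDerivAt (cauchyInv μ) (divDiff μ z z) z := by
  have hmem : ∀ᶠ w in 𝓝[≠] z, w ∈ lowerCone α := mem_nhdsWithin_of_mem_nhds ((isOpen_lowerCone α).mem_nhds hz)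
  rw [hasDerivAt_iff_tendsto_slope]
  refine (tendsto_divDiff μ (u := id) (v := fun _ => z) hα hmem (Eventually.of_forall fun _ => hz)
    nhdsWithin_le_nhds tendsto_const_nhds
    (one_sub_ne_zero_of_mem_lowerCone hα hz)).congr' ?_
  filter_upwards [hmem, self_mem_nhdsWithin] with w hw hne
  rw [slope_def_field, cauchyInv_sub μ hα hw hz, mul_div_cancel_left₀ _ (sub_ne_zero.2 hne), id]

theorem differentiableAt_inverseL {α β : ℝ} (h : IsGood μ α β)
    (hlip : ∀ z ∈ truncCone α β, ∀ w ∈ truncCone α β,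
      ‖cauchyInv μ z - cauchyInv μ w - (z - w)‖ ≤ 1 / 2 * ‖z - w‖) {w : ℂ}
    (hw : w ∈ truncCone (α - margin α) ((1 - margin α) * β)) :
    DifferentiableAt ℂ (inverseL μ) w := by
  have hnhds := (isOpen_truncCone (α - margin α) ((1 - margin α) * β)).mem_nhds hw
  have hL := inverseL_spec h hw
  set z := inverseL μ w with hz
  have hderiv := hasDerivAt_cauchyInv μ h.1 hL.1.1
  have hne : divDiff μ z z ≠ 0 := by
    intro h0
    have h1 := (hderiv.sub (hasDerivAt_id z)).le_of_lip' (C := 1 / 2) (by norm_num) (by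
      filter_upwards [(isOpen_truncCone α β).mem_nhds hL.1] with u hu
      simpa [sub_sub_sub_comm] using hlip u hu z hL.1)
    rw [h0] at h1
    norm_num at h1
  refine (HasDerivAt.of_local_left_inverse ?_ hderiv hne ?_).differentiableAt
  · rw [ContinuousAt, tendsto_iff_norm_sub_tendsto_zero]
    refine squeeze_zero' (g := fun u => 2 * ‖u - w‖) (Eventually.of_forall fun _ => norm_nonneg _)
      ?_ ?_
    · filter_upwards [hnhds] with u hu
      have hu' := inverseL_spec h hu
      have h1 := hlip _ hu'.1 _ hL.1
      rw [hu'.2, hL.2] at h1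
      have h2 : ‖inverseL μ u - z‖ ≤ ‖u - w‖ + ‖u - w - (inverseL μ u - z)‖ := by
        simpa using norm_sub_le (u - w) (u - w - (inverseL μ u - z))
      linarith
    · have : ContinuousAt (fun u : ℂ => 2 * ‖u - w‖) w := by fun_prop
      simpa [ContinuousAt] using this
  · filter_upwards [hnhds] with u hu using (inverseL_spec h hu).2

/-- The R-transform is analytic on a domain that contains truncated cones of all apertures. -/
theorem exists_domain_rTransform : ∃ D : Set ℂ, IsOpen D ∧ IsConnected D ∧ (0 : ℂ) ∉ D ∧
    DifferentiableOn ℂ (rTransform μ) D ∧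
    ∀ α : ℝ, 0 < α → ∃ β : ℝ, 0 < β ∧ truncCone α β ⊆ D := by
  choose! b hb hlip using fun (α : ℝ) (hα : 0 < α) => exists_isGood μ hα
  set C : Set.Ioi (0 : ℝ) → Set ℂ := fun α =>
    truncCone (α.1 - margin α) ((1 - margin α) * b α) with hC
  have hpos : ∀ α : Set.Ioi (0 : ℝ), 0 < α.1 - margin α ∧ 0 < (1 - margin α) * b α := fun α => by
    have h1 := margin_le_half α.1
    have h2 := margin_le_self_div α.1
    have h3 : 0 < α.1 := α.2
    have h4 := (hb α α.2).2.1
    exact ⟨by linarith, mul_pos (by linarith) h4⟩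
  refine ⟨⋃ α, C α, isOpen_iUnion fun α => isOpen_truncCone _ _, ?_, ?_, ?_, ?_⟩
  · refine IsConnected.iUnion_of_reflTransGen (fun α => ?_) fun α α' => ?_
    · refine ⟨⟨_, neg_I_mem_truncCone (hpos α).1 (half_pos (hpos α).2) (half_lt_self (hpos α).2)⟩, ?_⟩
      exact (convex_truncCone _ _).isPreconnected
    · refine Relation.ReflTransGen.single ?_
      have hm := lt_min (hpos α).2 (hpos α').2
      exact ⟨_, neg_I_mem_truncCone (hpos α).1 (half_pos hm)
        ((half_lt_self hm).trans_le (min_le_left _ _)), neg_I_mem_truncCone (hpos α').1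
        (half_pos hm) ((half_lt_self hm).trans_le (min_le_right _ _))⟩
  · simp only [Set.mem_iUnion, not_exists]
    intro α h
    exact ne_zero_of_mem_lowerCone (hpos α).1 h.1 rfl
  · intro w hw
    obtain ⟨α, hα⟩ := Set.mem_iUnion.1 hw
    have hg := hb α α.2
    have hL := differentiableAt_inverseL μ hg (fun z hz => (hlip α α.2 z hz).2) hα
    have hL0 := ne_zero_of_mem_lowerCone hg.1 (inverseL_spec hg hα).1.1
    have hw0 := ne_zero_of_mem_lowerCone (hpos α).1 hα.1
    refine DifferentiableAt.differentiableWithinAt ?_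
    unfold rTransform
    exact ((differentiableAt_const _).div hL hL0).sub
      ((differentiableAt_const _).div differentiableAt_id hw0)
  · intro α hα
    have h1 : (0 : ℝ) < α + 1 := by linarith
    refine ⟨_, (hpos ⟨α + 1, h1⟩).2, (truncCone_mono hα ?_ le_rfl).trans
      (Set.subset_iUnion C ⟨α + 1, h1⟩)⟩
    have := margin_le_half (α + 1)
    simp only; linarith

/-- Taylor expansions of the R-transform amount to non-tangential limits. -/
theorem hasNTTaylor_rTransform {n : ℕ} {a : ℕ → ℂ}
    (h : ∀ α : ℝ, 0 < α → Tendsto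
      (fun w => (rTransform μ w - ∑ i ∈ Finset.range (n + 1), a i * w ^ i) / w ^ n)
      (𝓝[lowerCone α] 0) (𝓝 0)) : HasNTTaylor (rTransform μ) n a := by
  obtain ⟨D, hD, hconn, h0, hdiff, hcone⟩ := exists_domain_rTransform μ
  refine ⟨⟨D, hD, hconn, hdiff.analyticOnNhd hD, hcone⟩,
    fun w => (rTransform μ w - ∑ i ∈ Finset.range (n + 1), a i * w ^ i) / w ^ n,
    ⟨D, hD, hconn, DifferentiableOn.analyticOnNhd (fun w hw => ?_) hD, hcone⟩, ?_, ?_⟩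
  · have hw0 : w ≠ 0 := fun h => h0 (h ▸ hw)
    exact ((hdiff w hw).sub (by fun_prop)).div (by fun_prop) (pow_ne_zero _ hw0)
  · intro α hα
    exact ⟨1, one_pos, by rw [nhdsWithin_truncCone α one_pos]; exact h α hα⟩
  · intro α hα
    refine ⟨1, one_pos, fun w hw => ?_⟩
    have hw0 := ne_zero_of_mem_lowerCone hα hw.1
    field_simp
    ring

end

noncomputable section

variable (μ : Measure ℝ)

theorem integrable_pow_mul_inv {j : ℕ} (hj : Integrable (fun t : ℝ => t ^ j) μ) {α : ℝ}
    (hα : 0 < α) {z : ℂ} (hz : z ∈ lowerCone α) :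
    Integrable (fun t : ℝ => (t : ℂ) ^ j * (1 - t * z)⁻¹) μ := by
  refine (hj.abs.mul_const (1 + α)).mono' (by fun_prop : Measurable _).aestronglyMeasurable
    (Eventually.of_forall fun t => ?_)
  rw [norm_mul, ← Complex.ofReal_pow, Complex.norm_real, Real.norm_eq_abs]
  exact mul_le_mul_of_nonneg_left (norm_inv_one_sub_le hα hz t) (abs_nonneg _)

theorem pow_mul_inv_eq {α : ℝ} (hα : 0 < α) {z : ℂ} (hz : z ∈ lowerCone α) (j : ℕ) (t : ℝ) :
    (t : ℂ) ^ j * (1 - t * z)⁻¹ = (t : ℂ) ^ j + z * ((t : ℂ) ^ (j + 1) * (1 - t * z)⁻¹) := by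
  have h := mul_inv_cancel₀ (one_sub_ne_zero_of_mem_lowerCone hα hz t)
  linear_combination (t : ℂ) ^ j * h

theorem integrable_pow_succ_mul_inv {j : ℕ} (hj : Integrable (fun t : ℝ => t ^ j) μ) {α : ℝ}
    (hα : 0 < α) {z : ℂ} (hz : z ∈ lowerCone α) :
    Integrable (fun t : ℝ => (t : ℂ) ^ (j + 1) * (1 - t * z)⁻¹) μ := by
  have hj' : Integrable (fun t : ℝ => (t : ℂ) ^ j) μ := by simpa using hj.ofReal (𝕜 := ℂ)
  refine (((integrable_pow_mul_inv μ hj hα hz).sub hj').const_mul z⁻¹).congr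
    (Eventually.of_forall fun t => ?_)
  have hz0 := ne_zero_of_mem_lowerCone hα hz
  simp only [Pi.sub_apply]
  rw [pow_mul_inv_eq hα hz j t, add_sub_cancel_left, inv_mul_cancel_left₀ hz0]

theorem resolventMoment_eq_add {j : ℕ} (hj : Integrable (fun t : ℝ => t ^ j) μ) {α : ℝ}
    (hα : 0 < α) {z : ℂ} (hz : z ∈ lowerCone α) :
    resolventMoment μ j z = (∫ t : ℝ, t ^ j ∂μ : ℝ) + z * resolventMoment μ (j + 1) z := by
  have hj' : Integrable (fun t : ℝ => (t : ℂ) ^ j) μ := by simpa using hj.ofReal (𝕜 := ℂ)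
  rw [resolventMoment, integral_congr_ae (Eventually.of_forall (pow_mul_inv_eq hα hz j)),
    integral_add hj' ((integrable_pow_succ_mul_inv μ hj hα hz).const_mul z), integral_const_mul,
    resolventMoment, ← integral_complex_ofReal]
  simp

theorem integrable_pow_of_le [IsFiniteMeasure μ] {i p : ℕ} (hip : i ≤ p)
    (hp : Integrable (fun t : ℝ => t ^ p) μ) : Integrable (fun t : ℝ => t ^ i) μ := by
  refine ((integrable_const (1 : ℝ)).add hp.abs).mono' (by fun_prop)
    (Eventually.of_forall fun t => ?_)
  simp only [Pi.add_apply, Real.norm_eq_abs, abs_pow]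
  have h0 := abs_nonneg t
  rcases le_total |t| 1 with h | h
  · exact (pow_le_one₀ h0 h).trans (by have := pow_nonneg h0 p; linarith)
  · exact (pow_le_pow_right₀ h hip).trans (by linarith)

theorem resolventMoment_zero_eq_sum [IsFiniteMeasure μ] {p : ℕ}
    (hp : Integrable (fun t : ℝ => t ^ p) μ) {α : ℝ} (hα : 0 < α) {z : ℂ}
    (hz : z ∈ lowerCone α) : resolventMoment μ 0 z =
      ∑ i ∈ Finset.range p, ((∫ t : ℝ, t ^ i ∂μ : ℝ) : ℂ) * z ^ i +
        z ^ p * resolventMoment μ p z := by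
  have : ∀ q ≤ p, resolventMoment μ 0 z =
      ∑ i ∈ Finset.range q, ((∫ t : ℝ, t ^ i ∂μ : ℝ) : ℂ) * z ^ i +
        z ^ q * resolventMoment μ q z := by
    intro q
    induction q with
    | zero => simp
    | succ q ih =>
      intro hq
      rw [ih (by omega), resolventMoment_eq_add μ (integrable_pow_of_le μ (by omega) hp) hα hz,
        Finset.sum_range_succ]
      ring
  exact this p le_rfl

open Asymptotics

theorem isLittleO_pow_sub_pow {ι : Type*} {l : Filter ι} {a b f : ι → ℂ}
    (ha : a =O[l] fun _ => (1 : ℂ)) (hb : b =O[l] fun _ => (1 : ℂ))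
    (hab : (fun i => a i - b i) =o[l] f) (n : ℕ) : (fun i => a i ^ n - b i ^ n) =o[l] f := by
  induction n with
  | zero => simp
  | succ n ih =>
    have h1 : (fun i => a i ^ n * (a i - b i)) =o[l] f := by
      simpa using (ha.pow n).mul_isLittleO hab
    have h2 : (fun i => b i * (a i ^ n - b i ^ n)) =o[l] f := by
      simpa using hb.mul_isLittleO ih
    exact (h1.add h2).congr_left fun i => by ring

variable [IsProbabilityMeasure μ]

theorem tendsto_resolventMoment_zero {α : ℝ} (hα : 0 < α) :
    Tendsto (resolventMoment μ 0) (𝓝[lowerCone α] 0) (𝓝 1) := by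
  simpa using tendsto_resolventMoment μ (j := 0) (by simp) hα

theorem resolventMoment_sub_sum_isLittleO {p : ℕ} (hp : Integrable (fun t : ℝ => t ^ p) μ) {α : ℝ}
    (hα : 0 < α) : (fun z => resolventMoment μ 0 z -
      ∑ i ∈ Finset.range (p + 1), ((∫ t : ℝ, t ^ i ∂μ : ℝ) : ℂ) * z ^ i)
        =o[𝓝[lowerCone α] 0] fun z => z ^ p := by
  have h1 : (fun z => resolventMoment μ p z - ((∫ t : ℝ, t ^ p ∂μ : ℝ) : ℂ))
      =o[𝓝[lowerCone α] 0] fun _ => (1 : ℂ) := by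
    rw [isLittleO_one_iff]
    simpa using (tendsto_resolventMoment μ hp hα).sub_const ((∫ t : ℝ, t ^ p ∂μ : ℝ) : ℂ)
  have h2 := (isBigO_refl (fun z : ℂ => z ^ p) (𝓝[lowerCone α] 0)).mul_isLittleO h1
  simp only [mul_one] at h2
  refine h2.congr' ?_ EventuallyEq.rfl
  filter_upwards [self_mem_nhdsWithin] with z hz
  rw [resolventMoment_zero_eq_sum μ hp hα hz, Finset.sum_range_succ]
  ring

open Polynomial in
/-- The functional equation of the free cumulants, up to order `p`. -/
theorem resolventMoment_cumulant_isLittleO {p : ℕ} (hp : Integrable (fun t : ℝ => t ^ p) μ)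
    {α : ℝ} (hα : 0 < α) : (fun z => resolventMoment μ 0 z - 1 -
      ∑ i ∈ Finset.range p, (freeCumulant μ (i + 1) : ℂ) * (z * resolventMoment μ 0 z) ^ (i + 1))
        =o[𝓝[lowerCone α] 0] fun z => z ^ p := by
  set l := 𝓝[lowerCone α] (0 : ℂ) with hl
  set m : ℕ → ℝ := fun j => ∫ t : ℝ, t ^ j ∂μ with hm
  set T : ℝ[X] := PowerSeries.trunc (p + 1) (PowerSeries.mk m) with hTdef
  have hid : Tendsto (fun z : ℂ => z) l (𝓝 0) := nhdsWithin_le_nhds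
  have hT : ∀ z : ℂ, aeval z T = ∑ i ∈ Finset.range (p + 1), ((m i : ℝ) : ℂ) * z ^ i := by
    intro z
    simp [hTdef, aeval_def, PowerSeries.eval₂_trunc_eq_sum_range]
  have hMT : (fun z => resolventMoment μ 0 z - aeval z T) =o[l] fun z => z ^ p := by
    simp only [hT]
    exact resolventMoment_sub_sum_isLittleO μ hp hα
  have hTO : (fun z : ℂ => aeval z T) =O[l] fun _ => (1 : ℂ) :=
    (((T.continuous_aeval (A := ℂ)).tendsto 0).mono_left nhdsWithin_le_nhds).isBigO_one ℂ
  have hMO : (resolventMoment μ 0) =O[l] fun _ => (1 : ℂ) :=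
    (tendsto_resolventMoment_zero μ hα).isBigO_one ℂ
  have hidO : (fun z : ℂ => z) =O[l] fun _ => (1 : ℂ) := hid.isBigO_one ℂ
  obtain ⟨E, hE⟩ := X_pow_dvd_moment_cumulant m (by simp [hm]) p
  have hE' : ∀ z : ℂ, aeval z T - 1 - ∑ i ∈ Finset.range p, (freeCumulant μ (i + 1) : ℂ) *
      (z * aeval z T) ^ (i + 1) = z ^ p * (z * aeval z E) := by
    intro z
    have := congrArg (aeval z) hE
    simp only [← hTdef, map_sub, map_one, map_sum, map_mul, map_pow, aeval_X, aeval_C,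
      Complex.coe_algebraMap] at this
    rw [← mul_assoc, ← pow_succ]
    exact this
  have h1 : (fun z : ℂ => z ^ p * (z * aeval z E)) =o[l] fun z => z ^ p := by
    have : (fun z : ℂ => z * aeval z E) =o[l] fun _ => (1 : ℂ) := by
      rw [isLittleO_one_iff]
      have hc : Continuous fun z : ℂ => z * aeval z E := by fun_prop
      simpa using (hc.tendsto 0).mono_left (nhdsWithin_le_nhds (s := lowerCone α))
    simpa using (isBigO_refl (fun z : ℂ => z ^ p) l).mul_isLittleO this
  have h2 : ∀ i, (fun z : ℂ => (z * resolventMoment μ 0 z) ^ (i + 1) - (z * aeval z T) ^ (i + 1))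
      =o[l] fun z => z ^ p := by
    intro i
    refine isLittleO_pow_sub_pow (by simpa using hidO.mul hMO) (by simpa using hidO.mul hTO) ?_ _
    simpa [mul_sub] using hidO.mul_isLittleO hMT
  have h3 := (hMT.add h1).sub (IsLittleO.sum (s := Finset.range p)
    fun i _ => (h2 i).const_mul_left (freeCumulant μ (i + 1) : ℂ))
  refine h3.congr_left fun z => ?_
  simp only [Finset.sum_apply, ← hE', mul_sub, Finset.sum_sub_distrib]
  ring

theorem tendsto_inverseL {α : ℝ} (hα : 0 < α) : ∃ α' : ℝ, 0 < α' ∧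
    Tendsto (inverseL μ) (𝓝[lowerCone α] 0) (𝓝[lowerCone α'] 0) ∧
    ∀ᶠ w in 𝓝[lowerCone α] 0, ‖inverseL μ w‖ ≤ 2 * ‖w‖ ∧ cauchyInv μ (inverseL μ w) = w := by
  have hα1 : 0 < α + 1 := by linarith
  obtain ⟨β, hβ, hid⟩ := exists_isGood μ hα1
  have hm := margin_le_half (α + 1)
  have hev : ∀ᶠ w in 𝓝[lowerCone α] (0 : ℂ),
      w ∈ truncCone (α + 1 - margin (α + 1)) ((1 - margin (α + 1)) * β) :=
    mem_nhdsWithin_lowerCone.2 ⟨(1 - margin (α + 1)) * β, mul_pos (by linarith) hβ.2.1,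
      truncCone_mono hα (by linarith) le_rfl⟩
  have hle : ∀ᶠ w in 𝓝[lowerCone α] (0 : ℂ),
      ‖inverseL μ w‖ ≤ 2 * ‖w‖ ∧ cauchyInv μ (inverseL μ w) = w := by
    filter_upwards [hev] with w hw
    obtain ⟨h1, h2⟩ := inverseL_spec hβ hw
    refine ⟨?_, h2⟩
    have h3 := (hid _ h1).1
    rw [h2] at h3
    have h4 : ‖inverseL μ w‖ ≤ ‖w‖ + ‖w - inverseL μ w‖ := by
      simpa using norm_sub_le w (w - inverseL μ w)
    linarith
  refine ⟨α + 1, hα1, tendsto_nhdsWithin_iff.2 ⟨?_, ?_⟩, hle⟩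
  · refine squeeze_zero_norm' (a := fun w => 2 * ‖w‖) (hle.mono fun w hw => hw.1) ?_
    have : Continuous fun w : ℂ => 2 * ‖w‖ := by fun_prop
    simpa using (this.tendsto 0).mono_left (nhdsWithin_le_nhds (s := lowerCone α))
  · filter_upwards [hev] with w hw using (inverseL_spec hβ hw).1.1

omit [IsProbabilityMeasure μ] in
theorem one_div_sub_one_div_cauchyInv {α : ℝ} (hα : 0 < α) {z : ℂ} (hz : z ∈ lowerCone α)
    (h : cauchyInv μ z ≠ 0) :
    1 / z - 1 / cauchyInv μ z = (resolventMoment μ 0 z - 1) / cauchyInv μ z := by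
  have hz0 := ne_zero_of_mem_lowerCone hα hz
  rw [cauchyInv_eq μ hz0] at h ⊢
  have h1 := right_ne_zero_of_mul h
  field_simp

/-- The Taylor expansion of the R-transform of a measure with a moment of order `n + 1`. -/
theorem hasNTTaylor_of_integrable {n : ℕ} (hp : Integrable (fun t : ℝ => t ^ (n + 1)) μ) :
    HasNTTaylor (rTransform μ) n fun i => (freeCumulant μ (i + 1) : ℂ) := by
  refine hasNTTaylor_rTransform μ fun α hα => ?_
  obtain ⟨α', hα', hL, hLw⟩ := tendsto_inverseL μ hα
  have h1 := (resolventMoment_cumulant_isLittleO μ hp hα').comp_tendsto hL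
  have h2 : (fun w => inverseL μ w ^ (n + 1)) =O[𝓝[lowerCone α] 0] fun w => w ^ (n + 1) :=
    (IsBigO.of_bound 2 (hLw.mono fun w hw => hw.1)).pow _
  have h3 := (h1.trans_isBigO h2).tendsto_div_nhds_zero
  refine h3.congr' ?_
  filter_upwards [hLw, self_mem_nhdsWithin, (tendsto_nhdsWithin_iff.1 hL).2] with w hw hwα hz
  have hw0 := ne_zero_of_mem_lowerCone hα hwα
  have hz0 := ne_zero_of_mem_lowerCone hα' hz
  have hR : rTransform μ w = (resolventMoment μ 0 (inverseL μ w) - 1) / w := by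
    have := one_div_sub_one_div_cauchyInv μ hα' hz (by rwa [hw.2])
    rwa [hw.2] at this
  have hzw := hw.2
  rw [cauchyInv_eq μ hz0] at hzw
  simp only [Function.comp, hzw, hR]
  rw [Finset.sum_congr rfl fun i _ => by rw [pow_succ, ← mul_assoc], ← Finset.sum_mul]
  field_simp
  ring

end

noncomputable section

open Asymptotics Polynomial

section Expansion

variable {ι : Type*} {l : Filter ι} {z f g : ι → ℂ} {q : ℕ}

/-- `f` has an expansion of order `q` in the small quantity `z` with real coefficients. -/
def HasRealExpansion (l : Filter ι) (z : ι → ℂ) (q : ℕ) (f : ι → ℂ) : Prop :=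
  ∃ P : ℝ[X], (fun i => f i - aeval (z i) P) =o[l] fun i => z i ^ q

theorem isBigO_one_aeval (hz : Tendsto z l (𝓝 0)) (P : ℝ[X]) :
    (fun i => aeval (z i) P) =O[l] fun _ => (1 : ℂ) :=
  (((P.continuous_aeval (A := ℂ)).tendsto 0).comp hz).isBigO_one ℂ

theorem isBigO_one_pow (hz : Tendsto z l (𝓝 0)) (q : ℕ) :
    (fun i => z i ^ q) =O[l] fun _ => (1 : ℂ) := by
  simpa using (hz.isBigO_one ℂ).pow q

theorem HasRealExpansion.isBigO_one (hz : Tendsto z l (𝓝 0)) (hf : HasRealExpansion l z q f) :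
    f =O[l] fun _ => (1 : ℂ) := by
  obtain ⟨P, hP⟩ := hf
  simpa using ((hP.isBigO.trans (isBigO_one_pow hz q)).add (isBigO_one_aeval hz P))

theorem hasRealExpansion_aeval (P : ℝ[X]) : HasRealExpansion l z q fun i => aeval (z i) P :=
  ⟨P, by simp⟩

theorem hasRealExpansion_const (c : ℝ) : HasRealExpansion l z q fun _ => (c : ℂ) := by
  simpa using hasRealExpansion_aeval (l := l) (z := z) (q := q) (C c)

theorem HasRealExpansion.congr_isLittleO (hf : HasRealExpansion l z q f)
    (h : (fun i => g i - f i) =o[l] fun i => z i ^ q) : HasRealExpansion l z q g := by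
  obtain ⟨P, hP⟩ := hf
  exact ⟨P, (h.add hP).congr_left fun i => by ring⟩

theorem HasRealExpansion.add (hf : HasRealExpansion l z q f) (hg : HasRealExpansion l z q g) :
    HasRealExpansion l z q fun i => f i + g i := by
  obtain ⟨P, hP⟩ := hf
  obtain ⟨Q, hQ⟩ := hg
  exact ⟨P + Q, (hP.add hQ).congr_left fun i => by simp only [map_add]; ring⟩

theorem HasRealExpansion.mul (hz : Tendsto z l (𝓝 0)) (hf : HasRealExpansion l z q f)
    (hg : HasRealExpansion l z q g) : HasRealExpansion l z q fun i => f i * g i := by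
  have hfO := hf.isBigO_one hz
  obtain ⟨P, hP⟩ := hf
  obtain ⟨Q, hQ⟩ := hg
  refine ⟨P * Q, ?_⟩
  have h1 : (fun i => f i * (g i - aeval (z i) Q)) =o[l] fun i => z i ^ q := by
    simpa using hfO.mul_isLittleO hQ
  have h2 : (fun i => aeval (z i) Q * (f i - aeval (z i) P)) =o[l] fun i => z i ^ q := by
    simpa using (isBigO_one_aeval hz Q).mul_isLittleO hP
  exact (h1.add h2).congr_left fun i => by simp only [map_mul]; ring

theorem HasRealExpansion.pow (hz : Tendsto z l (𝓝 0)) (hf : HasRealExpansion l z q f) (n : ℕ) :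
    HasRealExpansion l z q fun i => f i ^ n := by
  induction n with
  | zero => simpa using hasRealExpansion_const (l := l) (z := z) (q := q) 1
  | succ n ih => simpa only [pow_succ] using ih.mul hz hf

theorem HasRealExpansion.sum {κ : Type*} {s : Finset κ} {F : κ → ι → ℂ}
    (h : ∀ k ∈ s, HasRealExpansion l z q (F k)) :
    HasRealExpansion l z q fun i => ∑ k ∈ s, F k i := by
  classical
  induction s using Finset.induction_on with
  | empty => simpa using hasRealExpansion_const (l := l) (z := z) (q := q) 0
  | insert k s hk ih =>
    simp only [Finset.sum_insert hk]
    exact (h k (by simp)).add (ih fun k' hk' => h k' (Finset.mem_insert_of_mem hk'))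

theorem HasRealExpansion.self_mul (hf : HasRealExpansion l z q f) :
    HasRealExpansion l z (q + 1) fun i => z i * f i := by
  obtain ⟨P, hP⟩ := hf
  refine ⟨X * P, ?_⟩
  refine ((isBigO_refl z l).mul_isLittleO hP).congr (fun i => ?_) fun i => ?_
  · simp only [map_mul, aeval_X]; ring
  · ring

theorem aeval_eq_mul_divX_add (P : ℝ[X]) (x : ℂ) :
    aeval x P = x * aeval x P.divX + (P.coeff 0 : ℂ) := by
  conv_lhs => rw [← X_mul_divX_add P]
  simp only [map_add, map_mul, aeval_X, aeval_C, Complex.coe_algebraMap]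

theorem HasRealExpansion.of_eq_add [l.NeBot] {c : ℝ} (hz : Tendsto z l (𝓝 0))
    (hz0 : ∀ᶠ i in l, z i ≠ 0) (hf : HasRealExpansion l z (q + 1) f) (hfc : Tendsto f l (𝓝 c))
    (hfg : ∀ᶠ i in l, f i = c + z i * g i) : HasRealExpansion l z q g := by
  obtain ⟨P, hP⟩ := hf
  have hP0 : (P.coeff 0 : ℂ) = c := by
    have h1 : Tendsto (fun i => f i - aeval (z i) P) l (𝓝 0) := by
      refine hP.trans_tendsto ?_
      simpa using hz.pow (q + 1)
    have h2 := ((P.continuous_aeval (A := ℂ)).tendsto 0).comp hz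
    have h3 := h1.add h2
    simp only [Function.comp, sub_add_cancel, zero_add] at h3
    rw [tendsto_nhds_unique hfc h3, aeval_eq_mul_divX_add]
    simp
  refine ⟨P.divX, ?_⟩
  refine ((isBigO_refl (fun i => (z i)⁻¹) l).mul_isLittleO hP).congr' ?_ ?_
  · filter_upwards [hz0, hfg] with i hi hfi
    rw [hfi, aeval_eq_mul_divX_add P, hP0]
    field_simp
    ring
  · filter_upwards [hz0] with i hi
    rw [pow_succ]
    field_simp

theorem HasRealExpansion.exists_abs_im_le (hz : Tendsto z l (𝓝 0))
    (hf : HasRealExpansion l z (q + 1) f) : ∃ B : ℝ, ∀ᶠ i in l, |(f i).im| ≤ B * ‖z i‖ := by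
  obtain ⟨P, hP⟩ := hf
  have h1 : (fun i => f i - aeval (z i) P) =O[l] z := by
    refine hP.isBigO.trans ?_
    simpa [pow_succ] using (isBigO_one_pow hz q).mul (isBigO_refl z l)
  have h2 : (fun i => z i * aeval (z i) P.divX) =O[l] z := by
    simpa using (isBigO_refl z l).mul (isBigO_one_aeval hz P.divX)
  obtain ⟨B, hB⟩ := (h1.add h2).bound
  refine ⟨B, hB.mono fun i hi => le_trans ?_ hi⟩
  refine le_trans (le_of_eq ?_) (Complex.abs_im_le_norm _)
  congr 1
  rw [aeval_eq_mul_divX_add P]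
  simp

end Expansion

end

noncomputable section

open Asymptotics

variable {μ : Measure ℝ}

/-- A form of Fatou's lemma for the regularized moments. -/
theorem integrable_of_regularized_le [IsProbabilityMeasure μ] {h : ℝ → ℝ} (hm : Measurable h)
    {c B : ℝ} (hc : 0 ≤ c) (hch : ∀ᵐ t ∂μ, -c ≤ h t)
    (hB : ∀ᶠ s in 𝓝[>] (0 : ℝ), Integrable (fun t => h t / (1 + s ^ 2 * t ^ 2)) μ ∧
      ∫ t, h t / (1 + s ^ 2 * t ^ 2) ∂μ ≤ B) : Integrable h μ := by
  set F : ℝ → ℝ → ℝ := fun s t => h t / (1 + s ^ 2 * t ^ 2) + c / (1 + s ^ 2 * t ^ 2) with hF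
  have hden : ∀ s t : ℝ, 1 ≤ 1 + s ^ 2 * t ^ 2 := fun s t => by
    have : 0 ≤ s ^ 2 * t ^ 2 := by positivity
    linarith
  have hFm : ∀ s, Measurable (F s) := fun s => by fun_prop
  have hF0 : ∀ s, 0 ≤ᵐ[μ] F s := fun s => hch.mono fun t ht => by
    simp only [hF, Pi.zero_apply, ← add_div]
    exact div_nonneg (by linarith) (by linarith [hden s t])
  have hclim : ∀ t, Tendsto (fun s => ENNReal.ofReal (F s t)) (𝓝[>] 0)
      (𝓝 (ENNReal.ofReal (h t + c))) := by
    intro t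
    refine ENNReal.tendsto_ofReal ?_
    have : Continuous fun s : ℝ => F s t := by
      have h0 : ∀ s : ℝ, 1 + s ^ 2 * t ^ 2 ≠ 0 := fun s => (zero_lt_one.trans_le (hden s t)).ne'
      exact (Continuous.div (by fun_prop) (by fun_prop) h0).add
        (Continuous.div (by fun_prop) (by fun_prop) h0)
    have h2 := (this.tendsto 0).mono_left (nhdsWithin_le_nhds (s := Set.Ioi (0 : ℝ)))
    simpa [hF] using h2
  have hbound : ∀ᶠ s in 𝓝[>] (0 : ℝ),
      ∫⁻ t, ENNReal.ofReal (F s t) ∂μ ≤ ENNReal.ofReal (B + c) := by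
    filter_upwards [hB] with s hs
    have hcb : ∀ t, ‖c / (1 + s ^ 2 * t ^ 2)‖ ≤ c := fun t => by
      rw [Real.norm_of_nonneg (div_nonneg hc (by linarith [hden s t]))]
      exact div_le_self hc (hden s t)
    have hci : Integrable (fun t => c / (1 + s ^ 2 * t ^ 2)) μ :=
      Integrable.of_bound (C := c) (by fun_prop : Measurable _).aestronglyMeasurable
        (Eventually.of_forall hcb)
    refine (ofReal_integral_eq_lintegral_ofReal (hs.1.add hci) (hF0 s)).symm.trans_le ?_
    refine ENNReal.ofReal_le_ofReal ?_
    refine (integral_add hs.1 hci).trans_le ?_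
    refine add_le_add hs.2 ?_
    refine (integral_mono hci (integrable_const c) fun t => (le_abs_self _).trans (hcb t)).trans ?_
    simp
  have hlint : ∫⁻ t, ENNReal.ofReal (h t + c) ∂μ ≤ ENNReal.ofReal (B + c) := by
    calc ∫⁻ t, ENNReal.ofReal (h t + c) ∂μ
        = ∫⁻ t, liminf (fun s => ENNReal.ofReal (F s t)) (𝓝[>] 0) ∂μ :=
          lintegral_congr fun t => (hclim t).liminf_eq.symm
      _ ≤ liminf (fun s => ∫⁻ t, ENNReal.ofReal (F s t) ∂μ) (𝓝[>] 0) :=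
          lintegral_liminf_le fun s => (hFm s).ennreal_ofReal
      _ ≤ _ := liminf_le_of_frequently_le' hbound.frequently
  have hint : Integrable (fun t => h t + c) μ := by
    refine ⟨(hm.add_const c).aestronglyMeasurable, ?_⟩
    rw [hasFiniteIntegral_iff_ofReal (hch.mono fun t ht => by simp; linarith)]
    exact hlint.trans_lt ENNReal.ofReal_lt_top
  exact (hint.sub (integrable_const c)).congr (Eventually.of_forall fun t => by simp)

variable (μ)

theorem one_sub_mul_neg_I_inv (s t : ℝ) : (1 - t * (-(s * Complex.I)) : ℂ)⁻¹ =
    ((1 / (1 + s ^ 2 * t ^ 2) : ℝ) : ℂ) - (((s * t) / (1 + s ^ 2 * t ^ 2) : ℝ) : ℂ) * Complex.I := by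
  have h0 : (1 + s ^ 2 * t ^ 2 : ℝ) ≠ 0 := by positivity
  have h1 : (1 + (s : ℂ) ^ 2 * (t : ℂ) ^ 2) ≠ 0 := by exact_mod_cast h0
  refine inv_eq_of_mul_eq_one_right ?_
  push_cast
  have h2 := mul_inv_cancel₀ h1
  simp only [div_eq_mul_inv, one_mul]
  linear_combination h2 - (s : ℂ) ^ 2 * t ^ 2 * (1 + (s : ℂ) ^ 2 * (t : ℂ) ^ 2)⁻¹ * Complex.I_sq

theorem neg_I_mem_lowerCone {α s : ℝ} (hα : 0 < α) (hs : 0 < s) :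
    (-(s * Complex.I) : ℂ) ∈ lowerCone α :=
  (neg_I_mem_truncCone hα hs (lt_add_one s)).1

theorem re_resolventMoment_neg_I {j : ℕ} {s : ℝ} (hs : 0 < s)
    (hj : Integrable (fun t : ℝ => t ^ j) μ) :
    Integrable (fun t : ℝ => t ^ (j + 1) / (1 + s ^ 2 * t ^ 2)) μ ∧
    (resolventMoment μ (j + 1) (-(s * Complex.I))).re =
      ∫ t : ℝ, t ^ (j + 1) / (1 + s ^ 2 * t ^ 2) ∂μ := by
  have hi := integrable_pow_succ_mul_inv μ hj one_pos (neg_I_mem_lowerCone one_pos hs)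
  have heq : ∀ t : ℝ, ((t : ℂ) ^ (j + 1) * (1 - t * (-(s * Complex.I)))⁻¹).re =
      t ^ (j + 1) / (1 + s ^ 2 * t ^ 2) := by
    intro t
    rw [one_sub_mul_neg_I_inv, ← Complex.ofReal_pow, Complex.re_ofReal_mul]
    simp only [Complex.sub_re, Complex.ofReal_re, Complex.re_ofReal_mul, Complex.I_re]
    ring
  have h1 := hi.re
  have h2 := integral_re hi
  simp only [RCLike.re_to_complex, heq] at h1 h2
  exact ⟨h1, h2.symm⟩

theorem im_resolventMoment_neg_I {j : ℕ} {s : ℝ} (hs : 0 < s)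
    (hj : Integrable (fun t : ℝ => t ^ j) μ) :
    Integrable (fun t : ℝ => t ^ (j + 2) / (1 + s ^ 2 * t ^ 2)) μ ∧
    (resolventMoment μ (j + 1) (-(s * Complex.I))).im =
      -(s * ∫ t : ℝ, t ^ (j + 2) / (1 + s ^ 2 * t ^ 2) ∂μ) := by
  have hi := integrable_pow_succ_mul_inv μ hj one_pos (neg_I_mem_lowerCone one_pos hs)
  have heq : ∀ t : ℝ, ((t : ℂ) ^ (j + 1) * (1 - t * (-(s * Complex.I)))⁻¹).im =
      -s * (t ^ (j + 2) / (1 + s ^ 2 * t ^ 2)) := by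
    intro t
    rw [one_sub_mul_neg_I_inv, ← Complex.ofReal_pow, Complex.im_ofReal_mul]
    simp only [Complex.sub_im, Complex.ofReal_im, Complex.im_ofReal_mul, Complex.I_im]
    ring
  have h1 := hi.im
  have h2 := integral_im hi
  simp only [RCLike.im_to_complex, heq] at h1 h2
  rw [integrable_const_mul_iff (by simpa using hs.ne')] at h1
  rw [integral_const_mul] at h2
  exact ⟨h1, h2.symm.trans (neg_mul _ _)⟩

variable [IsProbabilityMeasure μ]

theorem tendsto_cauchyInv {a a' : ℝ} (ha : 0 < a) (haa' : a < a') :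
    Tendsto (cauchyInv μ) (𝓝[lowerCone a] 0) (𝓝[lowerCone a'] 0) := by
  set δ := (a' - a) / ((1 + a) * (1 + a')) with hδ
  have hden : 0 < (1 + a) * (1 + a') := by have := ha.trans haa'; positivity
  have hδ0 : 0 < δ := div_pos (by linarith) hden
  obtain ⟨β, hβ, h⟩ := exists_cauchyInv_near_id μ ha hδ0
  have hev : ∀ᶠ z in 𝓝[lowerCone a] (0 : ℂ), z ∈ truncCone a β :=
    mem_nhdsWithin_lowerCone.2 ⟨β, hβ, subset_rfl⟩
  refine tendsto_nhdsWithin_iff.2 ⟨?_, ?_⟩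
  · refine squeeze_zero_norm' (a := fun z => (1 + δ) * ‖z‖) ?_ ?_
    · filter_upwards [hev] with z hz
      have h1 := (h z hz).1
      have h2 : ‖cauchyInv μ z‖ ≤ ‖cauchyInv μ z - z‖ + ‖z‖ := by
        simpa using norm_add_le (cauchyInv μ z - z) z
      linarith
    · have : Continuous fun z : ℂ => (1 + δ) * ‖z‖ := by fun_prop
      simpa using (this.tendsto 0).mono_left (nhdsWithin_le_nhds (s := lowerCone a))
  · filter_upwards [hev] with z hz
    exact (mem_truncCone_of_norm_sub_le ha (ha.trans haa').le hδ0.le hz (h z hz).1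
      (div_mul_cancel₀ _ hden.ne').le le_rfl).1

theorem eventually_inverseL_cauchyInv :
    ∀ᶠ z in 𝓝[lowerCone (1 / 4)] (0 : ℂ), inverseL μ (cauchyInv μ z) = z := by
  obtain ⟨β, hβ, -⟩ := exists_isGood μ one_pos
  have hm : margin 1 = 1 / 2 := by norm_num [margin]
  have h1 := tendsto_cauchyInv μ (a := 1 / 4) (a' := 1 / 2) (by norm_num) (by norm_num)
  have h2 : truncCone (1 / 2) (1 / 2 * β) ∈ 𝓝[lowerCone (1 / 2)] (0 : ℂ) :=
    mem_nhdsWithin_lowerCone.2 ⟨_, mul_pos (by norm_num) hβ.2.1, subset_rfl⟩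
  have h3 : truncCone 1 β ∈ 𝓝[lowerCone (1 / 4)] (0 : ℂ) :=
    mem_nhdsWithin_lowerCone.2 ⟨β, hβ.2.1, truncCone_mono (by norm_num) (by norm_num) le_rfl⟩
  filter_upwards [h1 h2, h3] with z hz hz'
  refine inverseL_eq ⟨1, β, hβ, ?_, hz', rfl⟩
  rw [hm]
  norm_num at hz ⊢
  exact hz

/-- A real expansion of the R-transform yields one of the function `z ↦ z⁻¹ G_μ(1/z)`. -/
theorem hasRealExpansion_resolventMoment {n : ℕ} {a : ℕ → ℝ}
    (h : HasNTTaylor (rTransform μ) n fun i => (a i : ℂ)) {ι : Type*} {l : Filter ι} {z : ι → ℂ}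
    (hz : Tendsto z l (𝓝[lowerCone (1 / 4)] 0)) :
    HasRealExpansion l z (n + 1) fun i => resolventMoment μ 0 (z i) := by
  obtain ⟨-, v, -, hv, hR⟩ := h
  obtain ⟨hz0, hzc⟩ := tendsto_nhdsWithin_iff.1 hz
  set M : ι → ℂ := fun i => resolventMoment μ 0 (z i) with hM
  have hM1 : Tendsto M l (𝓝 1) := (tendsto_resolventMoment_zero μ (by norm_num)).comp hz
  have hMO : M =O[l] fun _ => (1 : ℂ) := hM1.isBigO_one ℂ
  have hw : Tendsto (fun i => cauchyInv μ (z i)) l (𝓝[lowerCone (1 / 2)] 0) :=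
    (tendsto_cauchyInv μ (by norm_num) (by norm_num)).comp hz
  obtain ⟨β, hβ, hβR⟩ := hR (1 / 2) (by norm_num)
  obtain ⟨β', hβ', hv'⟩ := hv (1 / 2) (by norm_num)
  rw [nhdsWithin_truncCone _ hβ'] at hv'
  have hwz : ∀ᶠ i in l, cauchyInv μ (z i) = z i * M i := hzc.mono fun i hi =>
    cauchyInv_eq μ (ne_zero_of_mem_lowerCone (by norm_num) hi)
  have hrem : (fun i => (z i * M i) ^ (n + 1) * v (cauchyInv μ (z i)))
      =o[l] fun i => z i ^ (n + 1) := by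
    have h1 : (fun i => z i * M i) =O[l] z := by simpa using (isBigO_refl z l).mul hMO
    have h2 : (fun i => v (cauchyInv μ (z i))) =o[l] fun _ => (1 : ℂ) :=
      (isLittleO_one_iff ℂ).2 (hv'.comp hw)
    simpa using (h1.pow (n + 1)).mul_isLittleO h2
  have hfun : ∀ᶠ i in l, M i = 1 + z i * ∑ k ∈ Finset.range (n + 1),
      (a k : ℂ) * (M i * (z i * M i) ^ k) + (z i * M i) ^ (n + 1) * v (cauchyInv μ (z i)) := by
    have hL := hz (eventually_inverseL_cauchyInv μ)
    have hcone := hw (mem_nhdsWithin_lowerCone.2 ⟨β, hβ, subset_rfl⟩)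
    filter_upwards [hL, hcone, hzc, hwz] with i hLi hci hzi hwi
    have hci : cauchyInv μ (z i) ∈ truncCone (1 / 2) β := hci
    have hLi : inverseL μ (cauchyInv μ (z i)) = z i := hLi
    have h1 := hβR _ hci
    have hw0 := ne_zero_of_mem_lowerCone (by norm_num) hci.1
    rw [rTransform, hLi, one_div_sub_one_div_cauchyInv μ (by norm_num) hzi hw0,
      div_eq_iff hw0, hwi] at h1
    change M i - 1 = _ at h1
    rw [hwi, Finset.mul_sum]
    rw [add_mul, Finset.sum_mul] at h1
    have h2 : ∀ k, z i * ((a k : ℂ) * (M i * (z i * M i) ^ k)) =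
        (a k : ℂ) * (z i * M i) ^ k * (z i * M i) := fun k => by ring
    simp only [h2]
    linear_combination h1
  have key : ∀ q ≤ n + 1, HasRealExpansion l z q M := by
    intro q
    induction q with
    | zero =>
      intro _
      refine (hasRealExpansion_const 1).congr_isLittleO ?_
      simp only [pow_zero, isLittleO_one_iff, Complex.ofReal_one]
      simpa using hM1.sub_const 1
    | succ q ih =>
      intro hq
      have ih := ih (by omega)
      have hzM : HasRealExpansion l z q fun i => z i * M i := by
        refine HasRealExpansion.mul hz0 ?_ ih
        simpa using hasRealExpansion_aeval (l := l) (z := z) (q := q) Polynomial.X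
      have hsum : HasRealExpansion l z q fun i => ∑ k ∈ Finset.range (n + 1),
          (a k : ℂ) * (M i * (z i * M i) ^ k) :=
        HasRealExpansion.sum fun k _ =>
          (hasRealExpansion_const (a k)).mul hz0 (ih.mul hz0 (hzM.pow hz0 k))
      refine ((hasRealExpansion_const 1).add hsum.self_mul).congr_isLittleO ?_
      have hpow : (fun i => z i ^ (n + 1)) =O[l] fun i => z i ^ (q + 1) := by
        obtain ⟨r, hr⟩ := Nat.exists_eq_add_of_le hq
        simpa [hr, pow_add] using (isBigO_refl (fun i => z i ^ (q + 1)) l).mul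
          (isBigO_one_pow hz0 r)
      refine (hrem.trans_isBigO hpow).congr' (hfun.mono fun i hi => ?_) EventuallyEq.rfl
      simp only [Complex.ofReal_one]
      linear_combination -hi
  exact key _ le_rfl

theorem tendsto_neg_I {α : ℝ} (hα : 0 < α) :
    Tendsto (fun s : ℝ => (-(s * Complex.I) : ℂ)) (𝓝[>] 0) (𝓝[lowerCone α] 0) := by
  refine tendsto_nhdsWithin_iff.2 ⟨?_, ?_⟩
  · have : Continuous fun s : ℝ => (-(s * Complex.I) : ℂ) := by fun_prop
    simpa using (this.tendsto 0).mono_left (nhdsWithin_le_nhds (s := Set.Ioi (0 : ℝ)))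
  · filter_upwards [self_mem_nhdsWithin] with s hs using neg_I_mem_lowerCone hα hs

omit [IsProbabilityMeasure μ] in
/-- Divide an expansion of `∫ t^j / (1 - tz) dμ(t)` by `z`. -/
theorem hasRealExpansion_resolventMoment_succ {j q : ℕ} (hj : Integrable (fun t : ℝ => t ^ j) μ)
    (h : HasRealExpansion (𝓝[>] 0) (fun s : ℝ => (-(s * Complex.I) : ℂ)) (q + 1)
      fun s => resolventMoment μ j (-(s * Complex.I))) :
    HasRealExpansion (𝓝[>] 0) (fun s : ℝ => (-(s * Complex.I) : ℂ)) q
      fun s => resolventMoment μ (j + 1) (-(s * Complex.I)) := by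
  have hz := tendsto_neg_I one_pos
  obtain ⟨hz0, hzc⟩ := tendsto_nhdsWithin_iff.1 hz
  exact h.of_eq_add hz0 (hzc.mono fun s hs => ne_zero_of_mem_lowerCone one_pos hs)
    ((tendsto_resolventMoment μ hj one_pos).comp hz)
    (hzc.mono fun s hs => resolventMoment_eq_add μ hj one_pos hs)

theorem integrable_even_of_hasRealExpansion {p : ℕ}
    (h : HasRealExpansion (𝓝[>] 0) (fun s : ℝ => (-(s * Complex.I) : ℂ)) p
      fun s => resolventMoment μ 0 (-(s * Complex.I))) (r q : ℕ) (hrq : 2 * r + q = p) :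
    Integrable (fun t : ℝ => t ^ (2 * r)) μ ∧
      HasRealExpansion (𝓝[>] 0) (fun s : ℝ => (-(s * Complex.I) : ℂ)) q
        fun s => resolventMoment μ (2 * r) (-(s * Complex.I)) := by
  have hz0 := (tendsto_nhdsWithin_iff.1 (tendsto_neg_I one_pos)).1
  induction r generalizing q with
  | zero =>
    obtain rfl : q = p := by omega
    exact ⟨by simp, h⟩
  | succ r ih =>
    obtain ⟨hi, hexp⟩ := ih (q + 2) (by omega)
    have hexp1 := hasRealExpansion_resolventMoment_succ μ hi hexp
    have hint : Integrable (fun t : ℝ => t ^ (2 * r + 2)) μ := by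
      obtain ⟨B, hB⟩ := hexp1.exists_abs_im_le hz0
      refine integrable_of_regularized_le (c := 0) (B := B) (by fun_prop) le_rfl
        (Eventually.of_forall fun t => ?_) ?_
      · have : Even (2 * r + 2) := ⟨r + 1, by ring⟩
        simpa using this.pow_nonneg t
      · filter_upwards [hB, self_mem_nhdsWithin] with s hs hs0
        obtain ⟨h1, h2⟩ := im_resolventMoment_neg_I μ hs0 hi
        refine ⟨h1, ?_⟩
        have hs0' : (0 : ℝ) < s := hs0
        rw [h2, abs_neg, abs_mul] at hs
        simp only [norm_neg, norm_mul, Complex.norm_real, Complex.norm_I, mul_one,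
          Real.norm_eq_abs, abs_of_pos hs0'] at hs
        rw [mul_comm] at hs
        exact (le_abs_self _).trans (le_of_mul_le_mul_right hs hs0')
    exact ⟨hint, hasRealExpansion_resolventMoment_succ μ
      (integrable_pow_of_le μ (Nat.le_succ _) hint) hexp1⟩

theorem integrable_odd_of_hasRealExpansion {r : ℕ}
    (hi : Integrable (fun t : ℝ => t ^ (2 * r)) μ)
    (h : HasRealExpansion (𝓝[>] 0) (fun s : ℝ => (-(s * Complex.I) : ℂ)) 1
      fun s => resolventMoment μ (2 * r) (-(s * Complex.I)))
    (hsupp : BddBelow μ.support ∨ BddAbove μ.support) :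
    Integrable (fun t : ℝ => t ^ (2 * r + 1)) μ := by
  have hz0 := (tendsto_nhdsWithin_iff.1 (tendsto_neg_I one_pos)).1
  obtain ⟨B, hB⟩ := ((hasRealExpansion_resolventMoment_succ μ hi h).isBigO_one hz0).bound
  simp only [norm_one, mul_one] at hB
  have hodd : Odd (2 * r + 1) := ⟨r, rfl⟩
  have hBre : ∀ᶠ s in 𝓝[>] (0 : ℝ),
      Integrable (fun t : ℝ => t ^ (2 * r + 1) / (1 + s ^ 2 * t ^ 2)) μ ∧
      |∫ t : ℝ, t ^ (2 * r + 1) / (1 + s ^ 2 * t ^ 2) ∂μ| ≤ B := by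
    filter_upwards [hB, self_mem_nhdsWithin] with s hs hs0
    obtain ⟨h1, h2⟩ := re_resolventMoment_neg_I μ hs0 hi
    exact ⟨h1, by rw [← h2]; exact (Complex.abs_re_le_norm _).trans hs⟩
  have hae : ∀ᵐ t ∂μ, t ∈ μ.support := Measure.support_mem_ae
  rcases hsupp with ⟨b, hb⟩ | ⟨b, hb⟩
  · refine integrable_of_regularized_le (c := |b| ^ (2 * r + 1)) (B := B) (by fun_prop)
      (by positivity) ?_ (hBre.mono fun s hs => ⟨hs.1, (le_abs_self _).trans hs.2⟩)
    filter_upwards [hae] with t ht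
    rw [← hodd.neg_pow]
    exact hodd.strictMono_pow.monotone ((neg_abs_le b).trans (hb ht))
  · have : Integrable (fun t : ℝ => -t ^ (2 * r + 1)) μ := by
      refine integrable_of_regularized_le (c := |b| ^ (2 * r + 1)) (B := B) (by fun_prop)
        (by positivity) ?_ (hBre.mono fun s hs => ?_)
      · filter_upwards [hae] with t ht
        exact neg_le_neg (hodd.strictMono_pow.monotone ((hb ht).trans (le_abs_self b)))
      · simp only [neg_div]
        exact ⟨hs.1.neg, by rw [integral_neg]; exact (neg_le_abs _).trans hs.2⟩
    simpa using this.neg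

end

end FreeProb

theorem theorem1p3 (p : ℕ) (hp : 1 ≤ p) (μ : Measure ℝ) [IsProbabilityMeasure μ] :
    (Integrable (fun t : ℝ => t ^ p) μ →
      FreeProb.HasNTTaylor (FreeProb.rTransform μ) (p - 1)
        (fun i => (FreeProb.freeCumulant μ (i + 1) : ℂ))) ∧
    ((Even p ∨ BddBelow μ.support ∨ BddAbove μ.support) →
      (∃ a : ℕ → ℝ, FreeProb.HasNTTaylor (FreeProb.rTransform μ) (p - 1) (fun i => (a i : ℂ))) →
      Integrable (fun t : ℝ => t ^ p) μ) := by
  obtain ⟨n, rfl⟩ : ∃ n, p = n + 1 := ⟨p - 1, by omega⟩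
  rw [Nat.add_sub_cancel]
  refine ⟨FreeProb.hasNTTaylor_of_integrable μ, ?_⟩
  rintro hcase ⟨a, ha⟩
  have hexp := FreeProb.hasRealExpansion_resolventMoment μ ha
    (FreeProb.tendsto_neg_I (by norm_num))
  rcases Nat.even_or_odd' (n + 1) with ⟨r, hr | hr⟩
  · rw [hr]
    exact (FreeProb.integrable_even_of_hasRealExpansion μ hexp r 0 (by omega)).1
  · obtain ⟨hi, h⟩ := FreeProb.integrable_even_of_hasRealExpansion μ hexp r 1 (by omega)
    rw [hr]
    refine FreeProb.integrable_odd_of_hasRealExpansion μ hi h (hcase.resolve_left ?_)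
    rw [hr, Nat.not_even_iff_odd]
    exact ⟨r, rfl⟩
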